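/- All graphs are finite and simple. A \emph{pentagulation} is a plane graph in which every face is bounded by a cycle of length 5. For a cycle $C$ in a plane graph, $\mathrm{Int}(C)$ and $\mathrm{ext}(C)$ denote the bounded and the unbounded component of the complement of $C$ in the plane; a set of vertices \emph{dominates} such a region if every vertex of the graph lying in the region belongs to the set or is adjacent to a member of it. Two distinct 4-cycles $C_1$ and $C_2$ of a pentagulation are \emph{dislocated} if there are regions $R_1 \in \{\mathrm{Int}(C_1), \mathrm{ext}(C_1)\}$ and $R_2 \in \{\mathrm{Int}(C_2), \mathrm{ext}(C_2)\}$ and two-element sets of vertices $\{u_1, v_1\} \subset V(C_1)$ and $\{u_2, v_2\} \subset V(C_2)$ such that (1) $\{u_1,v_1\}$ dominates $R_1$ and $\{u_2,v_2\}$ dominates $R_2$, (2) $\{u_1,v_1\} \neq \{u_2,v_2\}$, and (3) $R_1 \cap R_2 = \emptyset$. Let $\mathcal{I}$ be the graph with the 11 vertices $v_1,\dots,v_7,w_1,w_2,z_1,z_2$ and the 15 edges of the 4-cycles $v_1v_2v_3v_7$ and $v_3v_4v_5v_6$, the paths $v_1w_1w_2v_3$ and $v_3z_1z_2v_5$, and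 the edge $v_1v_5$. \textbf{Theorem.} Let $G$ be a pentagulation of diameter 3, order $n$ and maximum degree $\Delta \geq 3$. If $G$ contains two dislocated 4-cycles, then $G$ contains a (not necessarily induced) subgraph isomorphic to $\mathcal{I}$, or $n \leq 3\Delta - 1$. -/

import Mathlib

/-- A rotation system on a simple graph `G`: at every vertex, a cyclic order of the darts
(oriented edges) leaving that vertex. It records an embedding of `G` in an oriented surface:
`next d` is the dart that follows `d` in the rotation around the origin of `d`. -/
structure RotationSystem {V : Type*} (G : SimpleGraph V) where
  next : Equiv.Perm G.Dart
  next_fst : ∀ d : G.Dart, (next d).fst = d.fst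
  next_sameCycle : ∀ d d' : G.Dart, d.fst = d'.fst → next.SameCycle d d'

namespace RotationSystem

variable {V : Type*} {G : SimpleGraph V} (M : RotationSystem G)

/-- The face permutation. After traversing the dart `d` from `u` to `v`, the boundary walk of the
face beside `d` continues with the dart that follows `v → u` in the rotation around `v`. -/
def facePerm : Equiv.Perm G.Dart :=
  (Function.Involutive.toPerm SimpleGraph.Dart.symm SimpleGraph.Dart.symm_involutive).trans M.next

/-- The faces of the embedding: the orbits of the face permutation. -/
def Face : Type _ := Quotient (Equiv.Perm.SameCycle.setoid M.facePerm)

/-- The face beside the dart `d`. The two faces beside the edge of `d` are `M.face d` and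
`M.face d.symm`. -/
def face (d : G.Dart) : M.Face := Quotient.mk (Equiv.Perm.SameCycle.setoid M.facePerm) d

/-- The boundary walk of the face beside `d` is a cycle of length `k`: it closes up after `k` steps
and visits `k` distinct vertices. -/
def FaceBoundedByCycle (k : ℕ) (d : G.Dart) : Prop :=
  (M.facePerm ^ k) d = d ∧ Set.InjOn (fun i : ℕ => ((M.facePerm ^ i) d).fst) (Set.Iio k)

/-- One can pass from the face `f` to the face `g` by crossing an edge that is not in `S`. -/
def Crosses (S : Set (Sym2 V)) (f g : M.Face) : Prop :=
  ∃ d : G.Dart, d.edge ∉ S ∧ M.face d = f ∧ M.face d.symm = g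

/-- The vertex `v` lies in the region which is left when the cycle `C` is removed and whose faces
are those of `R`: it is not on `C`, and some face at `v` (equivalently each, because none of the
edges at `v` is in `C`) belongs to `R`. -/
def VertexInRegion {a : V} (C : G.Walk a a) (R : Set M.Face) (v : V) : Prop :=
  v ∉ C.support ∧ ∃ d : G.Dart, d.fst = v ∧ M.face d ∈ R

/-- The pair `{u, v}` of vertices of `C` dominates the region `R` of `C`. -/
def PairDominates {a : V} (C : G.Walk a a) (R : Set M.Face) (u v : V) : Prop :=
  ∀ x : V, M.VertexInRegion C R x → G.Adj u x ∨ G.Adj v x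

end RotationSystem

/-- A plane embedding of a connected finite simple graph `G` with at least one edge, up to
homeomorphism of the plane: a rotation system of genus `0` (Euler characteristic `2`), that is, an
embedding in the sphere, with one face singled out as the outer (unbounded) face. -/
structure PlaneEmbedding {V : Type*} [Finite V] (G : SimpleGraph V) extends RotationSystem G where
  connected : G.Connected
  euler : Nat.card V + Nat.card toRotationSystem.Face = Nat.card G.edgeSet + 2
  outer : toRotationSystem.Face

namespace PlaneEmbedding

variable {V : Type*} [Finite V] {G : SimpleGraph V} (M : PlaneEmbedding G)

/-- Every face is bounded by a cycle of length `5`. -/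
def IsPentagulation : Prop := ∀ d : G.Dart, M.FaceBoundedByCycle 5 d

/-- The exterior of a cycle `C`, as a set of faces: the faces that are joined to the outer face
without crossing `C`. -/
def exterior {a : V} (C : G.Walk a a) : Set M.Face :=
  {f | Relation.ReflTransGen (M.Crosses C.edgeSet) M.outer f}

/-- The interior of a cycle `C`, as a set of faces: the faces that `C` separates from the outer
face. -/
def interior {a : V} (C : G.Walk a a) : Set M.Face := (M.exterior C)ᶜ

/-- `C₁` and `C₂` are dislocated 4-cycles. Two regions are disjoint as subsets of the plane exactly
if they have no face in common, because a nonempty open set meets some face. -/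
def Dislocated {a b : V} (C₁ : G.Walk a a) (C₂ : G.Walk b b) : Prop :=
  (C₁.IsCycle ∧ C₁.length = 4) ∧ (C₂.IsCycle ∧ C₂.length = 4) ∧
  C₁.toSubgraph ≠ C₂.toSubgraph ∧
  ∃ R₁ R₂ : Set M.Face,
    (R₁ = M.interior C₁ ∨ R₁ = M.exterior C₁) ∧
    (R₂ = M.interior C₂ ∨ R₂ = M.exterior C₂) ∧
    ∃ u₁ v₁ u₂ v₂ : V,
      (u₁ ≠ v₁ ∧ u₁ ∈ C₁.support ∧ v₁ ∈ C₁.support) ∧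
      (u₂ ≠ v₂ ∧ u₂ ∈ C₂.support ∧ v₂ ∈ C₂.support) ∧
      M.PairDominates C₁ R₁ u₁ v₁ ∧ M.PairDominates C₂ R₂ u₂ v₂ ∧
      ({u₁, v₁} : Set V) ≠ {u₂, v₂} ∧
      Disjoint R₁ R₂

end PlaneEmbedding

/-- The graph `𝓘`. The vertices `0, …, 6` are `v₁, …, v₇`, the vertices `7, 8` are `w₁, w₂` and the
vertices `9, 10` are `z₁, z₂`. It consists of the 4-cycles `v₁v₂v₃v₇` and `v₃v₄v₅v₆`, the paths
`v₁w₁w₂v₃` and `v₃z₁z₂v₅`, and the edge `v₁v₅`. -/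
def graphI : SimpleGraph (Fin 11) :=
  SimpleGraph.fromEdgeSet
    {s(0, 1), s(1, 2), s(2, 6), s(6, 0),
     s(2, 3), s(3, 4), s(4, 5), s(5, 2),
     s(0, 7), s(7, 8), s(8, 2),
     s(2, 9), s(9, 10), s(10, 4),
     s(0, 4)}

/-! ### Crossing parity around a vertex, and vertices on one side of an edge set -/

section

open Finset
open scoped Classical

namespace RotationSystem

variable {V : Type*} {G : SimpleGraph V} (M : RotationSystem G)

/-! A region dominated by two of its boundary vertices is very small. If one side of a `p`-cycle has
`f` faces and `i` inner vertices, Euler's formula gives `3f + 2 = 2i + p` (`region_count`). If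
boundary vertices `u`, `v` dominate this side, they have at least `i + 2` corners in it, while a
pentagonal face holds two such corners only if `u` and `v` are joined along it by an edge or by a
path of length two. Counting these coincidences (`card_inside_le`) shows that no side of a triangle
is dominated by two of its vertices, and no side of a 4-cycle by two consecutive ones. For two
opposite vertices, cutting along common neighbours inside leaves two faces and two inner vertices,
which form a thin path `u a b v` with `a`, `b` of degree two (`exists_thinPath`). So each of two
dislocated cycles gives a "lens" with a thin path.

Diameter three acts through the thin paths. Inner vertices of two different thin paths can only be
joined by a short path through adjacent ends (`adj_ends`), and a vertex adjacent to neither end of a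
thin path has a common neighbour with each end (`exists_common_nbr`). If the two dominating pairs
are disjoint, their four vertices form a 4-cycle, and a vertex that they do not dominate would lie
on neither side of it. If the pairs share `v`, the other two, `u₁` and `u₂`, are adjacent. Then
either the lenses have no second vertex in common and the graph `𝓘` appears, or they share a further
vertex `x` and `{u₁, u₂, v, x}` dominates.

A dominating set of four vertices inducing at least four edges forces `n ≤ 3Δ - 1`, by counting the
corners of faces at these vertices (`card_add_one_le`).

The plane topology is combinatorial. Over `ZMod 2`, vertex coboundaries and face boundaries are
orthogonal, and the dimension count of `region_exact` yields both a Jordan theorem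
(`exists_isBoundary`) and Euler's formula for a region (`euler_region`). -/

theorem face_facePerm (d : G.Dart) : M.face (M.facePerm d) = M.face d :=
  Quotient.sound (s := Equiv.Perm.SameCycle.setoid M.facePerm)
    (Equiv.Perm.sameCycle_apply_left.2 (Equiv.Perm.SameCycle.refl _ _))

theorem facePerm_apply (d : G.Dart) : M.facePerm d = M.next d.symm := rfl

theorem facePerm_fst (d : G.Dart) : (M.facePerm d).fst = d.snd := by
  rw [facePerm_apply, M.next_fst]; rfl

theorem face_next (d : G.Dart) : M.face (M.next d) = M.face d.symm := by
  rw [← M.face_facePerm d.symm, facePerm_apply, SimpleGraph.Dart.symm_symm]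

theorem exists_face_eq (f : M.Face) : ∃ d, M.face d = f :=
  Quotient.exists_rep (s := Equiv.Perm.SameCycle.setoid M.facePerm) f

instance [Finite V] : Finite G.Dart :=
  Finite.of_injective _ SimpleGraph.Dart.toProd_injective

instance [Finite V] : Finite M.Face := Quotient.finite _

/-- The set `R` of faces has boundary `B`: the edges in `B` are those with exactly one side
in `R`. -/
def IsBoundary (R : Set M.Face) (B : Set (Sym2 V)) : Prop :=
  ∀ d : G.Dart, d.edge ∈ B ↔ (M.face d ∈ R ↔ M.face d.symm ∉ R)

/-- All faces at the vertex `v` belong to `R`. -/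
def Inside (R : Set M.Face) (v : V) : Prop := ∀ d : G.Dart, d.fst = v → M.face d ∈ R

variable {M}

theorem IsBoundary.compl {R : Set M.Face} {B : Set (Sym2 V)} (h : M.IsBoundary R B) :
    M.IsBoundary Rᶜ B := by
  intro d
  rw [h d]
  simp only [Set.mem_compl_iff]
  tauto

/-- Going round `v`, the far side of each dart is the near side of the next one, so both sums run
over the same faces. -/
theorem sum_rotation [Fintype G.Dart] (g : M.Face → ℤ) (v : V) :
    ∑ d : G.Dart with d.fst = v, (g (M.face d) - g (M.face d.symm)) = 0 := by
  rw [sum_sub_distrib, sub_eq_zero]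
  symm
  refine sum_equiv M.next ?_ ?_
  · intro d; simp [M.next_fst]
  · intro d _; rw [M.face_next]

/-- Around a vertex, the edges that enter `R` and those that leave it balance. -/
theorem sum_crossing [Fintype G.Dart] (R : Set M.Face) (v : V) :
    ∑ d : G.Dart with d.fst = v,
      ((if M.face d ∈ R then 1 else 0) - (if M.face d.symm ∈ R then 1 else 0) : ℤ) = 0 :=
  sum_rotation (fun f => if f ∈ R then 1 else 0) v

/-- A set of faces cannot be entered exactly once on a tour around a vertex: in `sum_crossing` a
single term would remain. -/
theorem not_separating_of_unique [Finite V] {R : Set M.Face} (d₁ : G.Dart)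
    (h : ∀ d : G.Dart, d.fst = d₁.fst → d ≠ d₁ → (M.face d ∈ R ↔ M.face d.symm ∈ R)) :
    M.face d₁ ∈ R ↔ M.face d₁.symm ∈ R := by
  let _ : Fintype G.Dart := Fintype.ofFinite _
  have key := sum_crossing R d₁.fst
  rw [sum_eq_single d₁] at key
  · split_ifs at key <;> simp_all
  · intro d hd hne
    simp only [mem_filter, mem_univ, true_and] at hd
    simp [h d hd hne]
  · simp

/-- Only two terms remain in `sum_crossing`, so they cancel: one dart enters `R` where the other
leaves it. The direction is what later singles out one of the two boundary darts at a vertex. -/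
theorem separating_pair [Finite V] {R : Set M.Face} {d₁ d₂ : G.Dart} (hne : d₁ ≠ d₂)
    (hv : d₁.fst = d₂.fst)
    (h : ∀ d : G.Dart, d.fst = d₁.fst → d ≠ d₁ → d ≠ d₂ → (M.face d ∈ R ↔ M.face d.symm ∈ R)) :
    (M.face d₁ ∈ R ∧ M.face d₁.symm ∉ R) ↔ (M.face d₂ ∉ R ∧ M.face d₂.symm ∈ R) := by
  let _ : Fintype G.Dart := Fintype.ofFinite _
  have key := sum_crossing R d₁.fst
  rw [← sum_subset (s₁ := {d₁, d₂}), sum_pair hne] at key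
  · split_ifs at key <;> simp_all
  · intro d; simp only [mem_insert, mem_singleton, mem_filter, mem_univ, true_and]
    rintro (rfl | rfl)
    · rfl
    · exact hv.symm
  · intro d hd hd'
    simp only [mem_filter, mem_univ, true_and] at hd
    simp only [mem_insert, mem_singleton, not_or] at hd'
    simp [h d hd hd'.1 hd'.2]

/-- If no edge at a vertex has exactly one side in `R`, then the faces at this vertex are all in `R`
or all outside of `R`. -/
theorem face_mem_iff_of_fst_eq [Finite V] {R : Set M.Face} {d₁ d₂ : G.Dart} (hv : d₁.fst = d₂.fst)
    (h : ∀ d : G.Dart, d.fst = d₁.fst → (M.face d ∈ R ↔ M.face d.symm ∈ R)) :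
    M.face d₁ ∈ R ↔ M.face d₂ ∈ R := by
  obtain ⟨n, hn⟩ := (M.next_sameCycle d₁ d₂ hv).exists_nat_pow_eq
  rw [← hn]
  clear hn hv
  induction n with
  | zero => rfl
  | succ n ih =>
    rw [ih, pow_succ', Equiv.Perm.mul_apply, M.face_next]
    apply h
    clear ih
    induction n with
    | zero => rfl
    | succ n ih => rw [pow_succ', Equiv.Perm.mul_apply, M.next_fst, ih]

theorem eq_empty_or_univ [Finite V] (hc : G.Connected) {R : Set M.Face}
    (h : ∀ d : G.Dart, M.face d ∈ R ↔ M.face d.symm ∈ R) : R = ∅ ∨ R = Set.univ := by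
  have key : ∀ (u v : V) (p : G.Walk u v) (d d' : G.Dart), d.fst = u → d'.fst = v →
      (M.face d ∈ R ↔ M.face d' ∈ R) := by
    intro u v p
    induction p with
    | nil => intro d d' hd hd'; exact face_mem_iff_of_fst_eq (hd.trans hd'.symm) fun d _ => h d
    | cons hadj p ih =>
      rename_i u w v
      intro d d' hd hd'
      rw [← ih ⟨(w, u), hadj.symm⟩ d' rfl hd', h ⟨(w, u), hadj.symm⟩]
      exact face_mem_iff_of_fst_eq hd fun d _ => h d
  by_cases hR : ∃ f, f ∈ R
  · right
    obtain ⟨f, hf⟩ := hR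
    obtain ⟨d, rfl⟩ := M.exists_face_eq f
    ext f'
    obtain ⟨d', rfl⟩ := M.exists_face_eq f'
    simp only [Set.mem_univ, iff_true]
    obtain ⟨p⟩ := hc.preconnected d.fst d'.fst
    exact (key _ _ p d d' rfl rfl).1 hf
  · left
    push Not at hR
    exact Set.eq_empty_iff_forall_notMem.2 hR

/-! ### Position of vertices relative to a set of faces -/

theorem exists_dart_fst [Nontrivial V] (hc : G.Connected) (v : V) : ∃ d : G.Dart, d.fst = v := by
  obtain ⟨w, hw⟩ := hc.preconnected.exists_adj_of_nontrivial v
  exact ⟨⟨(v, w), hw⟩, rfl⟩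

theorem IsBoundary.inside_or [Finite V] {R : Set M.Face} {B : Set (Sym2 V)} (h : M.IsBoundary R B)
    {v : V} (hv : ∀ w, s(v, w) ∉ B) : M.Inside R v ∨ M.Inside Rᶜ v := by
  by_contra! hcon
  unfold Inside at hcon
  push Not at hcon
  obtain ⟨⟨d₁, h₁, h₁'⟩, d₂, h₂, h₂'⟩ := hcon
  rw [Set.mem_compl_iff, not_not] at h₂'
  refine h₁' ((face_mem_iff_of_fst_eq (h₁.trans h₂.symm) ?_).2 h₂')
  intro d hd
  have := (h d).not.1 (by
    have := hv d.snd
    rwa [← h₁, ← hd] at this)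
  tauto

/-- The face beside the dart from `v` to `w` is a face at both vertices. -/
theorem Inside.not_adj {R : Set M.Face} {v w : V} (hv : M.Inside R v) (hw : M.Inside Rᶜ w) :
    ¬ G.Adj v w := by
  intro hadj
  have h₁ := hv ⟨(v, w), hadj⟩ rfl
  have h₂ := hw (M.facePerm ⟨(v, w), hadj⟩) (M.facePerm_fst _)
  rw [M.face_facePerm] at h₂
  exact h₂ h₁

theorem Inside.face_symm_mem {R : Set M.Face} {d : G.Dart} (hv : M.Inside R d.fst) :
    M.face d ∈ R ∧ M.face d.symm ∈ R := by
  refine ⟨hv d rfl, ?_⟩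
  rw [← M.face_next]
  exact hv _ (M.next_fst d)

theorem Inside.face_symm_mem' {R : Set M.Face} {d : G.Dart} (hv : M.Inside R d.snd) :
    M.face d ∈ R ∧ M.face d.symm ∈ R :=
  (Inside.face_symm_mem (d := d.symm) hv).symm

theorem Inside.mono {R R' : Set M.Face} (h : R ⊆ R') {v : V} (hv : M.Inside R v) :
    M.Inside R' v := fun d hd => h (hv d hd)

theorem Inside.not_compl {R : Set M.Face} {v w : V} (hadj : G.Adj v w) (hv : M.Inside R v) :
    ¬ M.Inside Rᶜ v := fun h => h ⟨(v, w), hadj⟩ rfl (hv ⟨(v, w), hadj⟩ rfl)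

theorem IsBoundary.not_inside {R : Set M.Face} {B : Set (Sym2 V)} (h : M.IsBoundary R B)
    {v w : V} (hadj : G.Adj v w) (hB : s(v, w) ∈ B) : ¬ M.Inside R v := by
  intro hv
  have h₁ := (h ⟨(v, w), hadj⟩).1 hB
  have := Inside.face_symm_mem (d := ⟨(v, w), hadj⟩) hv
  tauto

theorem IsBoundary.inside_of_adj [Finite V] {R : Set M.Face} {B : Set (Sym2 V)}
    (h : M.IsBoundary R B) {v w : V} (hw : ∀ x, s(w, x) ∉ B) (hadj : G.Adj v w)
    (hv : M.Inside R v) : M.Inside R w :=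
  (h.inside_or hw).resolve_right fun h' => hv.not_adj h' hadj

end RotationSystem

end

/-! ### Mod 2 duality between the vertices and the faces of a region -/

section

open Finset
open scoped Classical

/-- Two injective linear maps with orthogonal ranges; if the dimensions add up, then the range of
the second is the orthogonal complement of the range of the first. -/
theorem orthogonal_ranges {K I U W : Type*} [Field K] [Fintype I] [AddCommGroup U] [Module K U]
    [AddCommGroup W] [Module K W] [FiniteDimensional K U] [FiniteDimensional K W]
    (P : U →ₗ[K] (I → K)) (Q : W →ₗ[K] (I → K)) (hP : Function.Injective P)
    (hQ : Function.Injective Q) (horth : ∀ u w, ∑ i, P u i * Q w i = 0) :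
    Module.finrank K U + Module.finrank K W ≤ Fintype.card I ∧
      (Module.finrank K U + Module.finrank K W = Fintype.card I →
        ∀ c : I → K, (∀ u, ∑ i, P u i * c i = 0) → ∃ w, Q w = c) := by
  set e := dotProductEquiv K I
  set A : Submodule K (I → K) := LinearMap.range P
  set B : Submodule K (I → K) := (A.dualAnnihilator).comap e.toLinearMap
  have hmem : ∀ c : I → K, c ∈ B ↔ ∀ u, ∑ i, P u i * c i = 0 := by
    intro c
    simp only [B, Submodule.mem_comap, Submodule.mem_dualAnnihilator, A, LinearMap.mem_range,
      forall_exists_index, forall_apply_eq_imp_iff]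
    refine forall_congr' fun u => ?_
    simp [e, dotProduct, mul_comm]
  have hB : Module.finrank K A + Module.finrank K B = Fintype.card I := by
    have h1 := Subspace.finrank_add_finrank_dualAnnihilator_eq A
    have h2 : Module.finrank K B = Module.finrank K A.dualAnnihilator := by
      have := (e.submoduleMap B).finrank_eq
      have hmap : Submodule.map (e : (I → K) →ₗ[K] _) B = A.dualAnnihilator :=
        Submodule.map_comap_eq_of_surjective e.surjective _
      rw [this, hmap]
    rw [h2, h1, Module.finrank_pi]
  have hle : LinearMap.range Q ≤ B := by
    rintro _ ⟨w, rfl⟩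
    exact (hmem _).2 fun u => horth u w
  have e1 : Module.finrank K A = Module.finrank K U := LinearMap.finrank_range_of_inj hP
  have e2 : Module.finrank K (LinearMap.range Q) = Module.finrank K W :=
    LinearMap.finrank_range_of_inj hQ
  have e3 := Submodule.finrank_mono hle
  refine ⟨by omega, fun heq c hc => ?_⟩
  have : LinearMap.range Q = B := Submodule.eq_of_le_of_finrank_le hle (by omega)
  have hcB := (hmem c).2 hc
  rw [← this] at hcB
  exact hcB

/-- A choice of one of the two darts of each edge. -/
def IsOrientation {V : Type*} {G : SimpleGraph V} (O : Finset G.Dart) : Prop :=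
  ∀ d : G.Dart, d ∈ O ↔ d.symm ∉ O

theorem exists_isOrientation {V : Type*} [Finite V] (G : SimpleGraph V) [Fintype G.Dart] :
    ∃ O : Finset G.Dart, IsOrientation O := by
  obtain ⟨n, ⟨e⟩⟩ := Finite.exists_equiv_fin V
  refine ⟨univ.filter fun d : G.Dart => e d.fst < e d.snd, fun d => ?_⟩
  have hne : e d.fst ≠ e d.snd := e.injective.ne d.fst_ne_snd
  simp only [mem_filter, mem_univ, true_and, SimpleGraph.Dart.symm]
  simp only [Prod.fst_swap, Prod.snd_swap, not_lt]
  exact ⟨le_of_lt, fun h => lt_of_le_of_ne h hne⟩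

theorem IsOrientation.sum {V : Type*} {G : SimpleGraph V} [Fintype G.Dart] {O : Finset G.Dart}
    (hO : IsOrientation O) {A : Type*} [AddCommMonoid A] (f : G.Dart → A) :
    ∑ d ∈ O, (f d + f d.symm) = ∑ d, f d := by
  rw [sum_add_distrib, ← sum_add_sum_compl O f]
  congr 1
  refine sum_nbij SimpleGraph.Dart.symm ?_ ?_ ?_ ?_
  · intro d hd; rw [mem_compl]; exact (hO d).1 hd
  · intro d _ d' _ h; exact SimpleGraph.Dart.symm_involutive.injective h
  · intro d hd
    refine ⟨d.symm, ?_, d.symm_symm⟩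
    rw [mem_coe, hO, d.symm_symm]
    exact mem_compl.1 hd
  · intros; rfl

theorem IsOrientation.two_mul_card {V : Type*} {G : SimpleGraph V} [Fintype G.Dart]
    {O : Finset G.Dart} (hO : IsOrientation O) (p : G.Dart → Prop) [DecidablePred p]
    (hp : ∀ d, p d ↔ p d.symm) :
    2 * #{d ∈ O | p d} = #{d : G.Dart | p d} := by
  rw [card_filter, card_filter, ← hO.sum, mul_sum]
  refine sum_congr rfl fun d _ => ?_
  rw [← if_congr (hp d) rfl rfl, two_mul]

namespace RotationSystem

variable {V : Type*} {G : SimpleGraph V} {M : RotationSystem G}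

/-- Coboundaries are orthogonal to boundaries: the rotation carries one half of the sum to the
other, so every corner is counted twice. -/
theorem sum_vertex_face_eq_zero [Fintype G.Dart] (h : V → ZMod 2) (g : M.Face → ZMod 2) :
    ∑ d : G.Dart, h d.fst * (g (M.face d) + g (M.face d.symm)) = 0 := by
  have : ∑ d : G.Dart, h d.fst * g (M.face d.symm) = ∑ d : G.Dart, h d.fst * g (M.face d) := by
    rw [← Equiv.sum_comp M.next (fun d => h d.fst * g (M.face d))]
    simp only [M.next_fst, M.face_next]
  simp only [mul_add, sum_add_distrib, this]
  exact CharTwo.add_self_eq_zero _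

/-- A set of faces is connected: one can pass between any two of its faces by crossing edges with
both sides in the set. -/
def FaceConnected (M : RotationSystem G) (R : Set M.Face) : Prop :=
  ∀ A ⊆ R, (∀ d : G.Dart, M.face d ∈ R → M.face d.symm ∈ R →
    (M.face d ∈ A ↔ M.face d.symm ∈ A)) → A = ∅ ∨ A = R

/-- The coboundary on functions supported on `S` is injective because `G` is connected and `w` is
missed. The boundary on functions supported on `R` without `f₀` is injective because `R` is
face-connected. Both map to functions on the edges with both sides in `R`, and their ranges are
orthogonal, so the dimensions add up to at most the number of these edges. In case of equality,
whatever is orthogonal to the coboundaries is a boundary. -/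
theorem region_exact [Fintype V] [Fintype G.Dart] [Fintype M.Face] (hc : G.Connected)
    {O : Finset G.Dart} (hO : IsOrientation O) {R : Set M.Face} (hR : M.FaceConnected R)
    {f₀ : M.Face} (hf₀ : f₀ ∈ R) {S : Set V} (hS : ∀ v ∈ S, M.Inside R v) {w : V} (hw : w ∉ S) :
    #{v : V | v ∈ S} + #{f : M.Face | f ∈ R} ≤ #{d ∈ O | M.face d ∈ R ∧ M.face d.symm ∈ R} + 1 ∧
    (#{v : V | v ∈ S} + #{f : M.Face | f ∈ R} =
        #{d ∈ O | M.face d ∈ R ∧ M.face d.symm ∈ R} + 1 →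
      ∀ c : G.Dart → ZMod 2,
        (∀ h : V → ZMod 2,
          ∑ d ∈ O with M.face d ∈ R ∧ M.face d.symm ∈ R, (h d.fst + h d.snd) * c d = 0) →
        ∃ g : M.Face → ZMod 2, ∀ d ∈ O, M.face d ∈ R → M.face d.symm ∈ R →
          g (M.face d) + g (M.face d.symm) = c d) := by
  rw [← Fintype.card_of_subtype (p := (· ∈ S)) {v : V | v ∈ S} (by simp),
    ← Fintype.card_of_subtype (p := (· ∈ R)) {f : M.Face | f ∈ R} (by simp)]
  set I : Finset G.Dart := {d ∈ O | M.face d ∈ R ∧ M.face d.symm ∈ R} with hI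
  let K := ZMod 2
  let R' : Set M.Face := R \ {f₀}
  let cob : (V → K) →ₗ[K] (I → K) :=
    { toFun := fun h d => h d.1.fst + h d.1.snd
      map_add' := fun x y => by ext d; simp only [Pi.add_apply]; ring
      map_smul' := fun a x => by ext d; simp [mul_add] }
  let bd : (M.Face → K) →ₗ[K] (I → K) :=
    { toFun := fun g d => g (M.face d.1) + g (M.face d.1.symm)
      map_add' := fun x y => by ext d; simp only [Pi.add_apply]; ring
      map_smul' := fun a x => by ext d; simp [mul_add] }
  let exS : (S → K) →ₗ[K] (V → K) := Function.ExtendByZero.linearMap K Subtype.val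
  let exR : (R' → K) →ₗ[K] (M.Face → K) := Function.ExtendByZero.linearMap K Subtype.val
  have exS_out : ∀ u v, v ∉ S → exS u v = 0 := by
    intro u v hv
    simp only [exS, Function.ExtendByZero.linearMap_apply]
    rw [Function.extend_apply' _ _ _ (by simpa using hv)]; rfl
  have exS_in : ∀ u (v : S), exS u v = u v := fun u v =>
    Subtype.val_injective.extend_apply _ _ _
  have exR_out : ∀ u v, v ∉ R' → exR u v = 0 := by
    intro u v hv
    simp only [exR, Function.ExtendByZero.linearMap_apply]
    rw [Function.extend_apply' _ _ _ (by simpa using hv)]; rfl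
  have exR_in : ∀ u (v : R'), exR u v = u v := fun u v =>
    Subtype.val_injective.extend_apply _ _ _
  have hP : Function.Injective (cob ∘ₗ exS) := by
    rw [injective_iff_map_eq_zero]
    intro u hu
    have hedge : ∀ v x, v ∈ S → G.Adj v x → exS u v = exS u x := by
      intro v x hv hadj
      have hin := Inside.face_symm_mem (d := ⟨(v, x), hadj⟩) (hS v hv)
      by_cases hd : (⟨(v, x), hadj⟩ : G.Dart) ∈ O
      · have := congrFun hu ⟨⟨(v, x), hadj⟩, mem_filter.2 ⟨hd, hin⟩⟩
        exact CharTwo.add_eq_zero.1 this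
      · rw [hO, not_not] at hd
        have := congrFun hu ⟨(⟨(v, x), hadj⟩ : G.Dart).symm, mem_filter.2 ⟨hd, hin.symm⟩⟩
        exact (CharTwo.add_eq_zero.1 this).symm
    have hz : ∀ v x (p : G.Walk v x), exS u x = 0 → exS u v = 0 := by
      intro v x p
      induction p with
      | nil => exact id
      | cons hadj p ih =>
        rename_i a b c
        intro hx
        by_cases ha : a ∈ S
        · rw [hedge _ _ ha hadj, ih hx]
        · exact exS_out _ _ ha
    ext v
    obtain ⟨p⟩ := hc.preconnected v.1 w
    rw [← exS_in u v, hz _ _ p (exS_out _ _ hw)]; rfl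
  have hQ : Function.Injective (bd ∘ₗ exR) := by
    rw [injective_iff_map_eq_zero]
    intro u hu
    -- The support of a function in the kernel is not separated inside `R`, so it is empty or all of
    -- `R`; the latter fails at `f₀`.
    have hA := hR {f | exR u f ≠ 0} (by
      intro f hf
      by_contra hfR
      exact hf (exR_out _ _ fun h => hfR h.1)) (by
      intro d h1 h2
      have : exR u (M.face d) = exR u (M.face d.symm) := by
        by_cases hd : d ∈ O
        · have := congrFun hu ⟨d, mem_filter.2 ⟨hd, h1, h2⟩⟩
          exact CharTwo.add_eq_zero.1 this
        · rw [hO, not_not] at hd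
          have := congrFun hu ⟨d.symm, mem_filter.2 ⟨hd, h2, by rwa [d.symm_symm]⟩⟩
          have := CharTwo.add_eq_zero.1 this
          simp only [d.symm_symm] at this
          exact this.symm
      simp only [Set.mem_ofPred_eq, this])
    have hA' : {f | exR u f ≠ 0} = ∅ := by
      refine hA.resolve_right fun h => ?_
      have : f₀ ∈ {f | exR u f ≠ 0} := h ▸ hf₀
      exact this (exR_out _ _ (by simp [R']))
    ext f
    rw [← exR_in u f]
    by_contra hne
    exact (Set.eq_empty_iff_forall_notMem.1 hA') f.1 hne
  have hsum : ∀ (u : S → K) (c : G.Dart → K),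
      (∀ d, c d = c d.symm) → ∑ d : I, (cob ∘ₗ exS) u d * c d.1 =
        ∑ d : G.Dart, exS u d.fst * c d := by
    intro u c hcs
    rw [← hO.sum]
    have e1 : ∑ d : I, (cob ∘ₗ exS) u d * c d.1 =
        ∑ d ∈ I, (exS u d.fst + exS u d.snd) * c d :=
      sum_coe_sort I fun d => (exS u d.fst + exS u d.snd) * c d
    rw [e1, hI, sum_filter]
    refine sum_congr rfl fun d _ => ?_
    rw [← hcs d]
    split_ifs with h
    · rw [add_mul]; rfl
    · have h1 : exS u d.fst = 0 := exS_out _ _ fun hin =>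
        h (Inside.face_symm_mem (hS _ hin))
      have h2 : exS u d.symm.fst = 0 := exS_out _ _ fun hin =>
        h (Inside.face_symm_mem' (d := d) (hS _ hin))
      rw [h1, h2]; simp
  have horth : ∀ u g, ∑ i, (cob ∘ₗ exS) u i * (bd ∘ₗ exR) g i = 0 := by
    intro u g
    have := hsum u (fun d => exR g (M.face d) + exR g (M.face d.symm))
      (fun d => by rw [d.symm_symm, add_comm])
    rw [sum_vertex_face_eq_zero] at this
    exact this
  have main := orthogonal_ranges (cob ∘ₗ exS) (bd ∘ₗ exR) hP hQ horth
  rw [Module.finrank_pi, Module.finrank_pi, Fintype.card_coe] at main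
  have hcard : Fintype.card {f // f ∈ R} = Fintype.card R' + 1 := by
    change Fintype.card R = _
    rw [← Set.toFinset_card, ← Set.toFinset_card, Set.toFinset_sdiff, Set.toFinset_singleton,
      card_sdiff_of_subset (by simpa using hf₀), card_singleton]
    have : 0 < #R.toFinset := card_pos.2 ⟨f₀, by simpa using hf₀⟩
    omega
  have hcS : Fintype.card {v // v ∈ S} = Fintype.card S := rfl
  refine ⟨by omega, fun heq c hcc => ?_⟩
  obtain ⟨g, hg⟩ := main.2 (by omega) (fun d => c d.1) (by
    intro u
    rw [← hcc (exS u)]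
    exact sum_coe_sort I fun d => (exS u d.fst + exS u d.snd) * c d)
  refine ⟨exR g, fun d hd h1 h2 => ?_⟩
  exact congrFun hg ⟨d, mem_filter.2 ⟨hd, h1, h2⟩⟩

end RotationSystem

end

/-! ### A mod 2 Jordan theorem, and counting along facial 5-cycles -/

section

open Finset
open scoped Classical

section

variable {V : Type*} {G : SimpleGraph V}

theorem sum_edge_orientation [Fintype G.Dart] {O : Finset G.Dart} (hO : IsOrientation O)
    (h : V → ZMod 2) {u v : V} (huv : G.Adj u v) :
    ∑ d ∈ O, (h d.fst + h d.snd) * (if s(u, v) = d.edge then 1 else 0) = h u + h v := by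
  let f : G.Dart → ZMod 2 := fun d => h d.fst * (if s(u, v) = d.edge then 1 else 0)
  have e1 : ∑ d ∈ O, (h d.fst + h d.snd) * (if s(u, v) = d.edge then 1 else 0) =
      ∑ d ∈ O, (f d + f d.symm) := by
    refine sum_congr rfl fun d _ => ?_
    simp only [f, SimpleGraph.Dart.edge_symm, add_mul]
    rfl
  rw [e1, hO.sum]
  set d₀ : G.Dart := ⟨(u, v), huv⟩
  rw [← sum_subset (subset_univ {d₀, d₀.symm}), sum_pair d₀.symm_ne.symm]
  · simp only [f, SimpleGraph.Dart.edge_symm]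
    change h u * (if s(u, v) = s(u, v) then 1 else 0) +
      h v * (if s(u, v) = s(u, v) then 1 else 0) = _
    rw [if_pos rfl, mul_one, mul_one]
  · intro d _ hd
    simp only [mem_insert, mem_singleton] at hd
    have : ¬ s(u, v) = d.edge := by
      intro h
      exact hd ((SimpleGraph.dart_edge_eq_iff d d₀).1 h.symm)
    simp [f, this]

/-- The sum telescopes along the walk. For closed walks it vanishes, which is the orthogonality
needed in `region_exact`. -/
theorem sum_walk_orientation [Fintype G.Dart] {O : Finset G.Dart} (hO : IsOrientation O)
    (h : V → ZMod 2) {a b : V} (p : G.Walk a b) :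
    ∑ d ∈ O, (h d.fst + h d.snd) * ((p.edges.count d.edge : ℕ) : ZMod 2) = h a + h b := by
  induction p with
  | nil => simp [CharTwo.add_self_eq_zero]
  | cons hadj p ih =>
    rename_i u v w
    have : ∀ d : G.Dart, (((SimpleGraph.Walk.cons hadj p).edges.count d.edge : ℕ) : ZMod 2) =
        (p.edges.count d.edge : ℕ) + (if s(u, v) = d.edge then 1 else 0) := by
      intro d
      rw [SimpleGraph.Walk.edges_cons, List.count_cons]
      push_cast
      simp
    simp only [this, mul_add, sum_add_distrib, ih, sum_edge_orientation hO h hadj]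
    have := CharTwo.add_self_eq_zero (h v)
    linear_combination this

end

namespace PlaneEmbedding

variable {V : Type*} [Fintype V] {G : SimpleGraph V} (M : PlaneEmbedding G)

theorem card_orientation [Fintype G.Dart] {O : Finset G.Dart} (hO : IsOrientation O) :
    #O = Nat.card G.edgeSet := by
  have h1 := hO.two_mul_card (fun _ => True) (fun _ => Iff.rfl)
  have h2 := G.dart_card_eq_twice_card_edges
  simp only [filter_true, card_univ] at h1
  rw [Nat.card_eq_fintype_card, ← SimpleGraph.edgeFinset_card]
  have h3 : Fintype.card G.Dart = @Fintype.card G.Dart SimpleGraph.Dart.fintype := by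
    congr!
  omega

theorem faceConnected_univ : M.FaceConnected Set.univ := by
  intro A _ hA
  exact RotationSystem.eq_empty_or_univ M.connected fun d => hA d trivial trivial

/-- Every closed trail is the boundary of a set of faces. -/
theorem exists_isBoundary {a : V} (p : G.Walk a a) (hp : p.edges.Nodup) :
    ∃ R : Set M.Face, M.IsBoundary R {e | e ∈ p.edges} := by
  let _ : Fintype G.Dart := Fintype.ofFinite _
  let _ : Fintype M.Face := Fintype.ofFinite _
  obtain ⟨O, hO⟩ := exists_isOrientation G
  have main := RotationSystem.region_exact (M := M.toRotationSystem) M.connected hO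
    M.faceConnected_univ (f₀ := M.outer) trivial (S := {a}ᶜ) (fun v _ d _ => trivial) (w := a)
    (by simp)
  have hcard : ∀ _ : DecidablePred (fun v => v ∈ ({a}ᶜ : Set V)),
      #{v : V | v ∈ ({a}ᶜ : Set V)} + 1 = Nat.card V := by
    intro _
    have : ({v : V | v ∈ ({a}ᶜ : Set V)} : Finset V) = univ.erase a := by
      ext v; simp
    rw [Nat.card_eq_fintype_card, this, card_erase_add_one (mem_univ a), card_univ]
  have heul := M.euler
  rw [← card_orientation hO, Nat.card_eq_fintype_card (α := M.Face)] at heul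
  -- Genus zero is exactly the equality case of `region_exact` for all faces and all vertices but
  -- `a`. The function to be written as a boundary counts how often `p` uses an edge; the region is
  -- then the set where `g` is `1`.
  obtain ⟨g, hg⟩ := main.2 (by
    have hu : ∀ _ : DecidablePred (fun f : M.Face => f ∈ (Set.univ : Set M.Face)),
        #{f : M.Face | f ∈ (Set.univ : Set M.Face)} = Fintype.card M.Face := by
      intro _
      rw [← card_univ]
      congr 1
      ext
      simp
    have hOu : ∀ _ : DecidablePred (fun d : G.Dart => M.face d ∈ (Set.univ : Set M.Face) ∧
          M.face d.symm ∈ (Set.univ : Set M.Face)),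
        #{d ∈ O | M.face d ∈ (Set.univ : Set M.Face) ∧
          M.face d.symm ∈ (Set.univ : Set M.Face)} = #O := by
      intro _
      congr 1
      ext
      simp
    rw [hu, hOu]
    have := hcard fun v => Classical.propDecidable _
    omega) (fun d => ((p.edges.count d.edge : ℕ) : ZMod 2)) (by
    intro h
    have := sum_walk_orientation hO h p
    rw [CharTwo.add_self_eq_zero] at this
    simpa using this)
  have hz : ∀ x y : ZMod 2, x + y = 1 ↔ (x = 1 ↔ ¬ y = 1) := by decide
  have hO' : ∀ d ∈ O, d.edge ∈ p.edges ↔ (g (M.face d) = 1 ↔ ¬ g (M.face d.symm) = 1) := by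
    intro d hd
    rw [← hz, hg d hd trivial trivial, List.Nodup.count hp]
    split_ifs with h <;> simp [h]
  refine ⟨{f | g f = 1}, fun d => ?_⟩
  simp only [Set.mem_ofPred_eq]
  by_cases hd : d ∈ O
  · exact hO' d hd
  · rw [hO, not_not] at hd
    have := hO' _ hd
    rw [SimpleGraph.Dart.edge_symm, d.symm_symm] at this
    rw [this]
    tauto

end PlaneEmbedding

namespace RotationSystem

variable {V : Type*} {G : SimpleGraph V} {M : RotationSystem G}

theorem facePerm_pow_fst_succ (d : G.Dart) (i : ℕ) :
    ((M.facePerm ^ (i + 1)) d).fst = ((M.facePerm ^ i) d).snd := by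
  rw [pow_succ', Equiv.Perm.mul_apply, M.facePerm_fst]

theorem face_facePerm_pow (d : G.Dart) (i : ℕ) : M.face ((M.facePerm ^ i) d) = M.face d := by
  induction i with
  | zero => rfl
  | succ i ih => rw [pow_succ', Equiv.Perm.mul_apply, M.face_facePerm, ih]

theorem exists_facePerm_pow_of_face_eq [Finite V] {d d' : G.Dart} {k : ℕ} (hk : 0 < k)
    (h : M.FaceBoundedByCycle k d) (hf : M.face d' = M.face d) :
    ∃ i < k, (M.facePerm ^ i) d = d' := by
  have hs : M.facePerm.SameCycle d d' :=
    (Quotient.exact (s := Equiv.Perm.SameCycle.setoid M.facePerm) hf).symm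
  obtain ⟨n, hn⟩ := hs.exists_nat_pow_eq
  refine ⟨n % k, Nat.mod_lt _ hk, ?_⟩
  rw [← hn]
  conv_rhs => rw [← Nat.mod_add_div n k, pow_add, pow_mul, Equiv.Perm.mul_apply]
  congr 1
  have : ∀ j, ((M.facePerm ^ k) ^ j) d = d := by
    intro j
    induction j with
    | zero => rfl
    | succ j ih => rw [pow_succ', Equiv.Perm.mul_apply, ih, h.1]
  exact (this _).symm

theorem sum_face [Finite V] [Fintype G.Dart] {d : G.Dart} {k : ℕ} (hk : 0 < k)
    (h : M.FaceBoundedByCycle k d) {A : Type*} [AddCommMonoid A] (F : G.Dart → A) :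
    ∑ e : G.Dart with M.face e = M.face d, F e = ∑ i ∈ range k, F ((M.facePerm ^ i) d) := by
  symm
  refine sum_nbij (fun i => (M.facePerm ^ i) d) ?_ ?_ ?_ ?_
  · intro i _
    simp [face_facePerm_pow]
  · intro i hi j hj hij
    exact h.2 (by simpa using hi) (by simpa using hj) (congrArg (fun d : G.Dart => d.fst) hij)
  · intro e he
    obtain ⟨i, hi, rfl⟩ := exists_facePerm_pow_of_face_eq hk h (by simpa using he)
    exact ⟨i, by simpa using hi, rfl⟩
  · intros; rfl

theorem eq_of_face_eq [Finite V] {d d' : G.Dart} {k : ℕ} (hk : 0 < k)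
    (h : M.FaceBoundedByCycle k d) (hf : M.face d' = M.face d) (hv : d'.fst = d.fst) : d' = d := by
  obtain ⟨i, hi, rfl⟩ := exists_facePerm_pow_of_face_eq hk h hf
  have : i = 0 := h.2 hi (by simpa using hk) hv
  rw [this]; rfl

theorem sum_faces [Fintype G.Dart] [Fintype M.Face] (R : Set M.Face) (F : G.Dart → ℕ) :
    ∑ e : G.Dart with M.face e ∈ R, F e =
      ∑ f : M.Face with f ∈ R, ∑ e : G.Dart with M.face e = f, F e := by
  rw [← sum_fiberwise_of_maps_to (g := M.face) (t := univ.filter (· ∈ R)) (by simp)]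
  refine sum_congr rfl fun f hf => ?_
  rw [filter_filter]
  refine sum_congr ?_ fun _ _ => rfl
  ext e
  simp only [mem_filter, mem_univ, true_and] at hf ⊢
  exact ⟨fun h => h.2, fun h => ⟨h ▸ hf, h⟩⟩

theorem card_darts_eq [Finite V] [Fintype G.Dart] [Fintype M.Face] {k : ℕ} (hk : 0 < k)
    (h : ∀ d, M.FaceBoundedByCycle k d) (R : Set M.Face) :
    #{d : G.Dart | M.face d ∈ R} = k * #{f : M.Face | f ∈ R} := by
  rw [card_eq_sum_ones, sum_faces, mul_comm, ← smul_eq_mul, ← sum_const]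
  refine sum_congr rfl fun f _ => ?_
  obtain ⟨d, rfl⟩ := M.exists_face_eq f
  rw [sum_face hk (h d)]
  simp

theorem card_corners_le [Finite V] [Fintype G.Dart] [Fintype M.Face] {k : ℕ} (hk : 0 < k)
    (h : ∀ d, M.FaceBoundedByCycle k d) (R : Set M.Face) (v : V) :
    #{d : G.Dart | M.face d ∈ R ∧ d.fst = v} ≤ #{f : M.Face | f ∈ R} := by
  refine card_le_card_of_injOn M.face ?_ ?_
  · intro d hd
    simp only [coe_filter, mem_univ, true_and, Set.mem_ofPred_eq] at hd ⊢
    exact hd.1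
  · intro d hd d' hd' heq
    simp only [coe_filter, mem_univ, true_and, Set.mem_ofPred_eq] at hd hd'
    exact eq_of_face_eq hk (h d') heq (hd.2.trans hd'.2.symm)

/-- A fixed dart would leave a vertex of degree one, where the facial walk turns back and repeats a
vertex after two steps. -/
theorem next_ne (h : ∀ d, M.FaceBoundedByCycle 5 d) (d : G.Dart) : M.next d ≠ d := by
  intro hd
  have h1 : M.facePerm d.symm = d := by rw [M.facePerm_apply, d.symm_symm, hd]
  have h2 : ((M.facePerm ^ 2) d.symm).fst = ((M.facePerm ^ 0) d.symm).fst := by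
    rw [pow_two, Equiv.Perm.mul_apply, h1, M.facePerm_fst]; rfl
  have := (h d.symm).2 (by simp) (by simp) h2
  omega

/-- On a 5-cycle, the number of vertices in `X` exceeds by at most one the number of
pairs of consecutive `X`-vertices at distance at most two along the cycle. -/
theorem card_special_le [Finite V] [Fintype G.Dart] [Fintype M.Face]
    (h : ∀ d, M.FaceBoundedByCycle 5 d) (R : Set M.Face) (X : Set V) :
    #{d : G.Dart | M.face d ∈ R ∧ d.fst ∈ X} ≤ #{f : M.Face | f ∈ R} +
      #{d : G.Dart | M.face d ∈ R ∧ d.fst ∈ X ∧ d.snd ∈ X} +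
      #{d : G.Dart | M.face d ∈ R ∧ d.fst ∉ X ∧ d.snd ∈ X ∧ (M.next.symm d).snd ∈ X} := by
  -- A turn at a vertex outside `X` is the middle of three consecutive vertices of a facial walk,
  -- the outer two being in `X`; `facePerm` moves the count from the middle to the first of them.
  have e3 : #{d : G.Dart | M.face d ∈ R ∧ d.fst ∉ X ∧ d.snd ∈ X ∧ (M.next.symm d).snd ∈ X} =
      #{d : G.Dart | M.face d ∈ R ∧ d.fst ∈ X ∧ d.snd ∉ X ∧ (M.facePerm d).snd ∈ X} := by
    symm
    refine card_equiv M.facePerm fun d => ?_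
    simp only [mem_filter, mem_univ, true_and, M.face_facePerm, M.facePerm_fst]
    rw [show M.next.symm (M.facePerm d) = d.symm from by
      rw [M.facePerm_apply, Equiv.symm_apply_apply]]
    change _ ↔ _ ∧ _ ∧ _ ∧ d.fst ∈ X
    tauto
  rw [e3]
  have conv : ∀ (p : G.Dart → Prop) [DecidablePred p], #{d : G.Dart | M.face d ∈ R ∧ p d} =
      ∑ f : M.Face with f ∈ R, ∑ e : G.Dart with M.face e = f, if p e then 1 else 0 := by
    intro p _
    rw [← sum_faces, ← filter_filter, card_filter]
  rw [conv (fun d => d.fst ∈ X), conv (fun d => d.fst ∈ X ∧ d.snd ∈ X),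
    conv (fun d => d.fst ∈ X ∧ d.snd ∉ X ∧ (M.facePerm d).snd ∈ X), card_eq_sum_ones, ← sum_add_distrib, ← sum_add_distrib]
  refine sum_le_sum fun f _ => ?_
  obtain ⟨d, rfl⟩ := M.exists_face_eq f
  simp only [sum_face (by norm_num : 0 < 5) (h d)]
  have hs : ∀ i, ((M.facePerm ^ i) d).snd = ((M.facePerm ^ (i + 1)) d).fst :=
    fun i => (facePerm_pow_fst_succ d i).symm
  have hs' : ∀ i, (M.facePerm ((M.facePerm ^ i) d)).snd = ((M.facePerm ^ (i + 2)) d).fst := by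
    intro i
    rw [← Equiv.Perm.mul_apply, ← pow_succ', hs]
  have h5 : (M.facePerm ^ 5) d = d := (h d).1
  have h6 : (M.facePerm ^ 6) d = (M.facePerm ^ 1) d := by
    rw [show 6 = 1 + 5 from rfl, pow_add, Equiv.Perm.mul_apply, h5]
  simp only [hs, hs', sum_range_succ, sum_range_zero, zero_add, Nat.reduceAdd, h5, h6]
  -- The gaps between cyclically consecutive vertices of `X` sum to five, so at most one of them
  -- exceeds two.
  have key : ∀ a b c d e : Bool,
      ((if a = true then 1 else 0) + (if b = true then 1 else 0) + (if c = true then 1 else 0) +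
        (if d = true then 1 else 0) + (if e = true then 1 else 0) : ℕ) ≤
      1 + ((if a = true ∧ b = true then 1 else 0) + (if b = true ∧ c = true then 1 else 0) +
        (if c = true ∧ d = true then 1 else 0) + (if d = true ∧ e = true then 1 else 0) +
        (if e = true ∧ a = true then 1 else 0)) +
      ((if a = true ∧ ¬ b = true ∧ c = true then 1 else 0) +
        (if b = true ∧ ¬ c = true ∧ d = true then 1 else 0) +
        (if c = true ∧ ¬ d = true ∧ e = true then 1 else 0) +
        (if d = true ∧ ¬ e = true ∧ a = true then 1 else 0) +
        (if e = true ∧ ¬ a = true ∧ b = true then 1 else 0)) := by decide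
  have := key (decide (((M.facePerm ^ 0) d).fst ∈ X)) (decide (((M.facePerm ^ 1) d).fst ∈ X))
    (decide (((M.facePerm ^ 2) d).fst ∈ X)) (decide (((M.facePerm ^ 3) d).fst ∈ X))
    (decide (((M.facePerm ^ 4) d).fst ∈ X))
  simpa only [decide_eq_true_eq, pow_zero, Equiv.Perm.one_apply] using this

end RotationSystem

end

/-! ### A dominating quadruple that spans four edges bounds the order -/

section

open Finset
open scoped Classical

/-- Euler's formula with all faces of length five. -/
theorem PlaneEmbedding.three_mul_card_face {V : Type*} [Fintype V] {G : SimpleGraph V} (M : PlaneEmbedding G)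
    (h5 : M.IsPentagulation) : 3 * Nat.card M.Face + 4 = 2 * Fintype.card V := by
  let _ : Fintype G.Dart := Fintype.ofFinite _
  let _ : Fintype M.Face := Fintype.ofFinite _
  obtain ⟨O, hO⟩ := exists_isOrientation G
  have e1 := PlaneEmbedding.card_orientation hO
  have e2 := hO.two_mul_card (fun _ => True) (fun _ => Iff.rfl)
  have e3 := RotationSystem.card_darts_eq (by norm_num) h5 Set.univ
  simp only [Set.mem_univ, filter_true, card_univ] at e2 e3
  have e4 := M.euler
  rw [Nat.card_eq_fintype_card (α := V), Nat.card_eq_fintype_card (α := M.Face)] at e4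
  rw [Nat.card_eq_fintype_card (α := M.Face)]
  rw [← e1] at e4
  omega

namespace RotationSystem

variable {V : Type*} {G : SimpleGraph V} {M : RotationSystem G}

/-- At a vertex with `j` darts into `X` there are at most `j` turns, and none if `j = 1`, because
`next` has no fixed dart. Domination gives `j ≥ 1`, so turns plus two never exceed `2j`. -/
theorem card_turns_le [Fintype V] [Fintype G.Dart] (h5 : ∀ d, M.FaceBoundedByCycle 5 d)
    (X : Set V) (hdom : ∀ v ∉ X, ∃ x ∈ X, G.Adj v x) :
    #{d : G.Dart | d.fst ∉ X ∧ d.snd ∈ X ∧ (M.next.symm d).snd ∈ X} + 2 * #{v : V | v ∉ X} ≤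
      2 * #{d : G.Dart | d.fst ∉ X ∧ d.snd ∈ X} := by
  rw [card_eq_sum_card_fiberwise (f := fun d : G.Dart => d.fst) (t := {v : V | v ∉ X})
      (s := {d : G.Dart | d.fst ∉ X ∧ d.snd ∈ X ∧ (M.next.symm d).snd ∈ X})
      (by intro d; simp; tauto),
    card_eq_sum_card_fiberwise (f := fun d : G.Dart => d.fst) (t := {v : V | v ∉ X})
      (s := {d : G.Dart | d.fst ∉ X ∧ d.snd ∈ X}) (by intro d; simp; tauto),
    card_eq_sum_ones, mul_sum, ← sum_add_distrib, mul_sum]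
  refine sum_le_sum fun v hv => ?_
  simp only [mem_filter, mem_univ, true_and] at hv
  obtain ⟨x, hx, hadj⟩ := hdom v hv
  set A : Finset G.Dart := {d ∈ ({d : G.Dart | d.fst ∉ X ∧ d.snd ∈ X ∧ (M.next.symm d).snd ∈ X} : Finset G.Dart) | d.fst = v}
  set J : Finset G.Dart := {d ∈ ({d : G.Dart | d.fst ∉ X ∧ d.snd ∈ X} : Finset G.Dart) | d.fst = v}
  have hAJ : A ⊆ J := by
    intro d
    simp only [A, J, mem_filter, mem_univ, true_and]
    tauto
  have hmem : (⟨(v, x), hadj⟩ : G.Dart) ∈ J := by simp [J, hv, hx]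
  have hpos : 0 < #J := card_pos.2 ⟨_, hmem⟩
  have hle := card_le_card hAJ
  rcases (show #J = 1 ∨ 2 ≤ #J by omega) with h1 | h1
  · have : A = ∅ := by
      rw [eq_empty_iff_forall_notMem]
      intro d hd
      have hd' := hAJ hd
      have hd2 : M.next.symm d ∈ J := by
        simp only [A, J, mem_filter, mem_univ, true_and] at hd ⊢
        have : (M.next.symm d).fst = d.fst := by
          conv_rhs => rw [← Equiv.apply_symm_apply M.next d, M.next_fst]
        rw [this]
        tauto
      have := card_le_one.1 h1.le _ hd' _ hd2
      exact next_ne h5 (M.next.symm d) (by rw [Equiv.apply_symm_apply, ← this])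
    rw [this, h1]
    simp
  · omega

end RotationSystem

/-- If four vertices that induce at least four edges dominate a pentagulation, then the order is
at most `3 * Δ - 1`. -/
theorem PlaneEmbedding.card_add_one_le {V : Type*} [Fintype V] {G : SimpleGraph V}
    [DecidableRel G.Adj] (M : PlaneEmbedding G) (h5 : M.IsPentagulation) (X : Finset V)
    (hX : #X = 4) (hdom : ∀ v ∉ X, ∃ x ∈ X, G.Adj v x)
    (hedges : 8 ≤ #{d : G.Dart | d.fst ∈ X ∧ d.snd ∈ X}) :
    Fintype.card V + 1 ≤ 3 * G.maxDegree := by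
  let _ : Fintype M.Face := Fintype.ofFinite _
  have e1 := PlaneEmbedding.three_mul_card_face M h5
  have e2 := RotationSystem.card_turns_le h5 (X : Set V) (by simpa using hdom)
  have e3 := RotationSystem.card_special_le h5 Set.univ (X : Set V)
  rw [Nat.card_eq_fintype_card] at e1
  simp only [Set.mem_univ, filter_true, card_univ, true_and, mem_coe] at e2 e3
  have e4 : #{d : G.Dart | d.fst ∈ X} =
      #{d : G.Dart | d.fst ∈ X ∧ d.snd ∈ X} + #{d : G.Dart | d.fst ∈ X ∧ d.snd ∉ X} := by
    rw [← filter_filter, ← filter_filter, card_filter_add_card_filter_not]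
  have e5 : #{d : G.Dart | d.fst ∈ X ∧ d.snd ∉ X} = #{d : G.Dart | d.fst ∉ X ∧ d.snd ∈ X} := by
    refine card_equiv (Function.Involutive.toPerm _ SimpleGraph.Dart.symm_involutive) fun d => ?_
    simp [and_comm]
  have e6 : #{d : G.Dart | d.fst ∈ X} ≤ 4 * G.maxDegree := by
    rw [card_eq_sum_card_fiberwise (f := fun d : G.Dart => d.fst) (t := X)
      (by intro d; simp), ← hX, ← smul_eq_mul, ← sum_const]
    refine sum_le_sum fun v hv => ?_
    rw [filter_filter]
    refine le_trans (card_le_card ?_) ((G.dart_fst_fiber_card_eq_degree v).le.trans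
      (G.degree_le_maxDegree v))
    intro d
    simp
  have e7 : #{v : V | v ∉ X} + 4 = Fintype.card V := by
    rw [← hX, filter_not, filter_mem_eq_inter, univ_inter, ← card_univ,
      card_sdiff_add_card_eq_card (subset_univ _)]
  -- Let `I` count the darts within `X`, `J` those entering `X`, `T` the turns and `f` the faces.
  -- Then `J ≤ f + T`, `T + 2(n - 4) ≤ 2J`, `I + J ≤ 4Δ`, `I ≥ 8` and `3f + 4 = 2n` combine to `4n ≤
  -- 12Δ - 4`.
  omega

end

/-! ### Regions bounded by a cycle: connectedness and Euler's formula -/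

section

open Finset
open scoped Classical

/-- `B` is the edge set and `P` the vertex set of a cycle of `G`. -/
structure IsCycleOn {V : Type*} (G : SimpleGraph V) (B : Set (Sym2 V)) (P : Finset V) : Prop where
  nonempty : P.Nonempty
  two : ∀ v ∈ P, ∃ x y, x ≠ y ∧ G.Adj v x ∧ G.Adj v y ∧ ∀ z, s(v, z) ∈ B ↔ z = x ∨ z = y
  off : ∀ v ∉ P, ∀ z, s(v, z) ∉ B
  conn : ∀ f : Sym2 V → Prop,
    (∀ v x y, s(v, x) ∈ B → s(v, y) ∈ B → f s(v, x) → f s(v, y)) →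
      ∀ e ∈ B, ∀ e' ∈ B, f e → f e'

namespace RotationSystem

variable {V : Type*} {G : SimpleGraph V} {M : RotationSystem G}

theorem IsBoundary.not_inside_of_mem {R : Set M.Face} {B : Set (Sym2 V)} {P : Finset V}
    (h : M.IsBoundary R B) (hB : IsCycleOn G B P) {v : V} (hv : v ∈ P) : ¬ M.Inside R v := by
  obtain ⟨x, y, -, hx, -, hz⟩ := hB.two v hv
  exact h.not_inside hx ((hz x).2 (Or.inl rfl))

variable [Fintype V]

/-- At every vertex of a boundary cycle of `R`, exactly one of the two boundary darts has its face
in `R`. -/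
theorem IsBoundary.existsUnique_dart {R : Set M.Face} {B : Set (Sym2 V)} {P : Finset V}
    (h : M.IsBoundary R B) (hB : IsCycleOn G B P) {v : V} (hv : v ∈ P) :
    ∃! d : G.Dart, d.fst = v ∧ M.face d ∈ R ∧ M.face d.symm ∉ R := by
  obtain ⟨x, y, hxy, hx, hy, hz⟩ := hB.two v hv
  set d₁ : G.Dart := ⟨(v, x), hx⟩
  set d₂ : G.Dart := ⟨(v, y), hy⟩
  have hne : d₁ ≠ d₂ := fun h => hxy (congrArg (fun d : G.Dart => d.snd) h)
  have hother : ∀ d : G.Dart, d.fst = v → d ≠ d₁ → d ≠ d₂ →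
      (M.face d ∈ R ↔ M.face d.symm ∈ R) := by
    rintro ⟨⟨a, b⟩, hab⟩ rfl h1 h2
    have : s(a, b) ∉ B := by
      rw [hz]
      rintro (rfl | rfl)
      · exact h1 rfl
      · exact h2 rfl
    have h3 := (h ⟨(a, b), hab⟩).not.1 this
    tauto
  have hsep := separating_pair (R := R) hne rfl hother
  have h1 := (h d₁).1 ((hz x).2 (Or.inl rfl))
  have h2 := (h d₂).1 ((hz y).2 (Or.inr rfl))
  by_cases hd : M.face d₁ ∈ R
  · refine ⟨d₁, ⟨rfl, hd, h1.1 hd⟩, fun d ⟨e1, e2, e3⟩ => ?_⟩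
    by_contra hne'
    by_cases hd2 : d = d₂
    · subst hd2
      exact (hsep.1 ⟨hd, h1.1 hd⟩).1 e2
    · exact e3 ((hother d e1 hne' hd2).1 e2)
  · have hd2 : M.face d₂ ∈ R := by
      by_contra hd2
      have : M.face d₂.symm ∈ R := by tauto
      exact hd (hsep.2 ⟨hd2, this⟩).1
    refine ⟨d₂, ⟨rfl, hd2, h2.1 hd2⟩, fun d ⟨e1, e2, e3⟩ => ?_⟩
    by_contra hne'
    by_cases hd1 : d = d₁
    · subst hd1
      exact hd e2
    · exact e3 ((hother d e1 hd1 hne').1 e2)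

/-- Only edges of the cycle can separate `A`. At a vertex of the cycle its two edges separate `A`
together or not at all, so by `IsCycleOn.conn` either none of them does, or all do. In the latter
case no edge separates `R \ A`, which must be empty. -/
theorem IsBoundary.faceConnected (hc : G.Connected) {R : Set M.Face} {B : Set (Sym2 V)}
    {P : Finset V} (h : M.IsBoundary R B) (hB : IsCycleOn G B P) : M.FaceConnected R := by
  intro A hAR hA
  have hns : ∀ d : G.Dart, d.edge ∉ B → (M.face d ∈ A ↔ M.face d.symm ∈ A) := by
    intro d hd
    have h1 := (h d).not.1 hd
    by_cases h2 : M.face d ∈ R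
    · exact hA d h2 (by tauto)
    · have h3 : M.face d.symm ∉ R := by tauto
      exact ⟨fun h4 => absurd (hAR h4) h2, fun h4 => absurd (hAR h4) h3⟩
  by_cases hs : ∃ d : G.Dart, ¬ (M.face d ∈ A ↔ M.face d.symm ∈ A)
  · right
    obtain ⟨d₀, hd₀⟩ := hs
    have hd₀B : d₀.edge ∈ B := by
      by_contra hd
      exact hd₀ (hns d₀ hd)
    have hall := hB.conn (fun e => ∀ d : G.Dart, d.edge = e → ¬ (M.face d ∈ A ↔ M.face d.symm ∈ A))
      (by
        intro v x y hx hy hf d hd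
        by_cases hxy : x = y
        · subst hxy; exact hf d hd
        have hvP : v ∈ P := by
          by_contra hvP
          exact hB.off v hvP x hx
        obtain ⟨x', y', hxy', hx', hy', hz⟩ := hB.two v hvP
        have hadjx : G.Adj v x := by
          rcases (hz x).1 hx with rfl | rfl <;> assumption
        have hadjy : G.Adj v y := by
          rcases (hz y).1 hy with rfl | rfl <;> assumption
        have hrest : ∀ d : G.Dart, d.fst = v → d ≠ ⟨(v, x), hadjx⟩ → d ≠ ⟨(v, y), hadjy⟩ →
            (M.face d ∈ A ↔ M.face d.symm ∈ A) := by
          rintro ⟨⟨a, b⟩, hab⟩ rfl h1 h2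
          refine hns _ fun hin => ?_
          have hb : b ≠ x := by rintro rfl; exact h1 rfl
          have hb' : b ≠ y := by rintro rfl; exact h2 rfl
          have k1 := (hz b).1 hin
          have k2 := (hz x).1 hx
          have k3 := (hz y).1 hy
          grind
        have hne : (⟨(v, x), hadjx⟩ : G.Dart) ≠ ⟨(v, y), hadjy⟩ :=
          fun h => hxy (congrArg (fun d : G.Dart => d.snd) h)
        have hsep := separating_pair (R := A) hne rfl hrest
        have hsep' := separating_pair (R := A) hne.symm rfl fun d h1 h2 h3 => hrest d h1 h3 h2
        have hfx := hf ⟨(v, x), hadjx⟩ rfl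
        have hd' := (SimpleGraph.dart_edge_eq_iff d ⟨(v, y), hadjy⟩).1 hd
        rcases hd' with rfl | rfl
        · tauto
        · rw [SimpleGraph.Dart.symm_symm]
          tauto) d₀.edge hd₀B
    have hA' : ∀ d : G.Dart, d.edge ∈ B → ¬ (M.face d ∈ A ↔ M.face d.symm ∈ A) := by
      intro d hd
      refine hall d.edge hd ?_ d rfl
      intro d' hd'
      rcases (SimpleGraph.dart_edge_eq_iff d' d₀).1 hd' with rfl | rfl
      · exact hd₀
      · rw [SimpleGraph.Dart.symm_symm]; tauto
    have hdiff : R \ A = ∅ ∨ R \ A = Set.univ := by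
      refine eq_empty_or_univ hc fun d => ?_
      by_cases hd : d.edge ∈ B
      · have k1 := hA' d hd
        have k2 := (h d).1 hd
        have k3 := @hAR (M.face d)
        have k4 := @hAR (M.face d.symm)
        simp only [Set.mem_sdiff]
        tauto
      · have k1 := hns d hd
        have k2 := (h d).not.1 hd
        simp only [Set.mem_sdiff]
        tauto
    rcases hdiff with hd | hd
    · exact Set.Subset.antisymm hAR (Set.sdiff_eq_empty.1 hd)
    · exfalso
      have k1 : ∀ f, f ∉ A := fun f => ((Set.ext_iff.1 hd f).2 trivial).2
      exact hd₀ ⟨fun h => absurd h (k1 _), fun h => absurd h (k1 _)⟩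
  · push Not at hs
    rcases eq_empty_or_univ hc hs with h1 | h1
    · exact Or.inl h1
    · right
      rw [h1] at hAR ⊢
      exact (Set.univ_subset_iff.1 hAR).symm

theorem IsBoundary.card_boundary [Fintype G.Dart] {R : Set M.Face} {B : Set (Sym2 V)}
    {P : Finset V} (h : M.IsBoundary R B) (hB : IsCycleOn G B P) :
    #{d : G.Dart | M.face d ∈ R ∧ M.face d.symm ∉ R} = #P := by
  refine card_bij (fun d _ => d.fst) ?_ ?_ ?_
  · intro d hd
    simp only [mem_filter, mem_univ, true_and] at hd
    by_contra hP
    exact hB.off _ hP d.snd ((h d).2 (by tauto))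
  · intro d hd d' hd' heq
    simp only [mem_filter, mem_univ, true_and] at hd hd'
    have hP : d.fst ∈ P := by
      by_contra hP
      exact hB.off _ hP d.snd ((h d).2 (by tauto))
    exact (h.existsUnique_dart hB hP).unique ⟨rfl, hd⟩ ⟨heq.symm, hd'⟩
  · intro v hv
    obtain ⟨d, ⟨h1, h2⟩, -⟩ := h.existsUnique_dart hB hv
    exact ⟨d, by simpa using h2, h1⟩

end RotationSystem

namespace PlaneEmbedding

variable {V : Type*} [Fintype V] {G : SimpleGraph V} (M : PlaneEmbedding G)

/-- Euler's formula for a region bounded by a cycle. -/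
theorem euler_region [Fintype G.Dart] [Fintype M.Face] {R : Set M.Face} {B : Set (Sym2 V)}
    {P : Finset V} (h : M.IsBoundary R B) (hB : IsCycleOn G B P) :
    2 * #{v : V | M.Inside R v} + 2 * #{f : M.Face | f ∈ R} =
      #{d : G.Dart | M.face d ∈ R ∧ M.face d.symm ∈ R} + 2 := by
  obtain ⟨O, hO⟩ := exists_isOrientation G
  have hle : ∀ R : Set M.Face, M.IsBoundary R B →
      2 * #{v : V | M.Inside R v} + 2 * #{f : M.Face | f ∈ R} ≤
        #{d : G.Dart | M.face d ∈ R ∧ M.face d.symm ∈ R} + 2 := by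
    intro R h
    obtain ⟨v, hv⟩ := hB.nonempty
    obtain ⟨d, ⟨-, hd, -⟩, -⟩ := h.existsUnique_dart hB hv
    have := (RotationSystem.region_exact M.connected hO (h.faceConnected M.connected hB) hd
      (S := {v | M.Inside R v}) (fun _ h => h) (w := v) (h.not_inside_of_mem hB hv)).1
    rw [← hO.two_mul_card (fun d => M.face d ∈ R ∧ M.face d.symm ∈ R)
      (by intro d; rw [d.symm_symm]; tauto)]
    simp only [Set.mem_ofPred_eq] at this
    omega
  -- The inequalities for `R` and its complement add up to Euler's formula for the whole graph,
  -- since the cycle has as many vertices as edges. Hence both are equalities.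
  have h1 := hle R h
  obtain ⟨R', hR'⟩ : ∃ R', R' = Rᶜ := ⟨_, rfl⟩
  have hbd : M.IsBoundary R' B := hR' ▸ h.compl
  have hmem : ∀ f, f ∈ R' ↔ f ∉ R := fun f => by rw [hR']; rfl
  have h2 := hle R' hbd
  have k1 := h.card_boundary hB
  have k2 := hbd.card_boundary hB
  obtain ⟨v₀, hv₀⟩ := hB.nonempty
  obtain ⟨w₀, -, -, hadj₀, -⟩ := hB.two v₀ hv₀
  have hnt : Nontrivial V := ⟨v₀, w₀, hadj₀.ne⟩
  have e1 : #{v : V | M.Inside R v} + #{v : V | M.Inside R' v} + #P = Fintype.card V := by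
    rw [← card_union_of_disjoint, ← card_union_of_disjoint, ← card_univ]
    · congr 1
      ext v
      simp only [mem_union, mem_filter, mem_univ, true_and, iff_true]
      by_cases hv : v ∈ P
      · exact Or.inr hv
      · exact Or.inl (hR' ▸ h.inside_or (hB.off v hv))
    · rw [disjoint_left]
      intro v hv hvP
      simp only [mem_union, mem_filter, mem_univ, true_and] at hv
      exact hv.elim (h.not_inside_of_mem hB hvP) (hbd.not_inside_of_mem hB hvP)
    · rw [disjoint_left]
      intro v hv hv'
      simp only [mem_filter, mem_univ, true_and] at hv hv'
      obtain ⟨d, hd⟩ := RotationSystem.exists_dart_fst M.connected v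
      exact (hmem _).1 (hv' d hd) (hv d hd)
  have e2 : #{f : M.Face | f ∈ R} + #{f : M.Face | f ∈ R'} = Fintype.card M.Face := by
    rw [← card_univ, ← card_filter_add_card_filter_not (s := univ) (· ∈ R), filter_congr fun f _ => hmem f]
  have e3 : #{d : G.Dart | M.face d ∈ R ∧ M.face d.symm ∈ R} +
      #{d : G.Dart | M.face d ∈ R ∧ M.face d.symm ∉ R} +
      (#{d : G.Dart | M.face d ∈ R' ∧ M.face d.symm ∈ R'} +
      #{d : G.Dart | M.face d ∈ R' ∧ M.face d.symm ∉ R'}) = Fintype.card G.Dart := by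
    rw [← filter_filter, ← filter_filter, ← filter_filter, ← filter_filter,
      card_filter_add_card_filter_not, card_filter_add_card_filter_not]
    rw [← card_univ, ← card_filter_add_card_filter_not (s := univ) (M.face · ∈ R),
      filter_congr fun (d : G.Dart) _ => hmem (M.face d)]
  have e4 := M.euler
  have e5 := card_orientation hO
  have e6 := hO.two_mul_card (fun _ => True) (fun _ => Iff.rfl)
  simp only [filter_true, card_univ] at e6
  rw [Nat.card_eq_fintype_card (α := V), Nat.card_eq_fintype_card (α := M.Face), ← e5] at e4
  omega

/-- There are five darts per face of `R`; those with only one side in `R` are as many as the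
vertices of the cycle. -/
theorem region_count [Fintype G.Dart] [Fintype M.Face] (h5 : M.IsPentagulation)
    {R : Set M.Face} {B : Set (Sym2 V)} {P : Finset V} (h : M.IsBoundary R B)
    (hB : IsCycleOn G B P) :
    3 * #{f : M.Face | f ∈ R} + 2 = 2 * #{v : V | M.Inside R v} + #P := by
  have e1 := M.euler_region h hB
  have e2 := h.card_boundary hB
  have e3 := RotationSystem.card_darts_eq (by norm_num) h5 R
  have e4 : #{d : G.Dart | M.face d ∈ R ∧ M.face d.symm ∈ R} +
      #{d : G.Dart | M.face d ∈ R ∧ M.face d.symm ∉ R} = #{d : G.Dart | M.face d ∈ R} := by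
    rw [← filter_filter, ← filter_filter, card_filter_add_card_filter_not]
  omega

/-- The number of corners of a region at two vertices of its boundary that dominate it. -/
theorem card_inside_add_two_le [Fintype G.Dart] {R : Set M.Face} {B : Set (Sym2 V)}
    {P : Finset V} (h : M.IsBoundary R B) (hB : IsCycleOn G B P) {u v : V} (hu : u ∈ P)
    (hv : v ∈ P) (huv : u ≠ v) (hdom : ∀ z, M.Inside R z → G.Adj u z ∨ G.Adj v z) :
    #{z : V | M.Inside R z} + 2 ≤ #{d : G.Dart | M.face d ∈ R ∧ d.fst ∈ ({u, v} : Set V)} := by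
  -- The summand `2` comes from the boundary darts `d₁` at `u` and `d₂` at `v` with face in `R`;
  -- their heads are not inside, so they are not used to reach inner vertices.
  obtain ⟨d₁, ⟨h1, h1', h1''⟩, -⟩ := h.existsUnique_dart hB hu
  obtain ⟨d₂, ⟨h2, h2', h2''⟩, -⟩ := h.existsUnique_dart hB hv
  set S : Finset G.Dart := {d : G.Dart | M.face d ∈ R ∧ d.fst ∈ ({u, v} : Set V)}
  rw [← card_filter_add_card_filter_not (s := S) fun d => M.Inside R d.snd]
  refine Nat.add_le_add ?_ ?_
  · refine card_le_card_of_surjOn (fun d => d.snd) ?_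
    intro z hz
    simp only [coe_filter, mem_univ, true_and, Set.mem_ofPred_eq] at hz
    have : ∀ x, (hx : G.Adj x z) → x ∈ ({u, v} : Set V) →
        z ∈ (fun d : G.Dart => d.snd) '' ↑({d ∈ S | M.Inside R d.snd} : Finset G.Dart) := by
      intro x hx hxuv
      refine ⟨⟨(x, z), hx⟩, ?_, rfl⟩
      simp only [S, coe_filter, mem_filter, mem_univ, true_and, Set.mem_ofPred_eq]
      exact ⟨⟨(RotationSystem.Inside.face_symm_mem' (d := ⟨(x, z), hx⟩) hz).1, hxuv⟩, hz⟩
    rcases hdom z hz with hz' | hz'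
    · exact this u hz' (by simp)
    · exact this v hz' (by simp)
  · have hne : d₁ ≠ d₂ := by
      rintro rfl
      exact huv (h1.symm.trans h2)
    rw [← card_pair hne]
    refine card_le_card ?_
    intro d hd
    simp only [mem_insert, mem_singleton] at hd
    simp only [S, mem_filter, mem_univ, true_and]
    rcases hd with rfl | rfl
    · exact ⟨⟨h1', by simp [h1]⟩, fun hin => h1'' (RotationSystem.Inside.face_symm_mem' hin).2⟩
    · exact ⟨⟨h2', by simp [h2]⟩, fun hin => h2'' (RotationSystem.Inside.face_symm_mem' hin).2⟩

end PlaneEmbedding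

end

/-! ### Triangles and 4-cycles; dominated sides of triangles -/

section

open Finset
open scoped Classical

section Cycles

variable {V : Type*} {G : SimpleGraph V}

/-- The edges of the triangle `uvw`. -/
def triEdges (u v w : V) : Set (Sym2 V) := {s(u, v), s(v, w), s(w, u)}

/-- The edges of the 4-cycle `abcd`. -/
def quadEdges (a b c d : V) : Set (Sym2 V) := {s(a, b), s(b, c), s(c, d), s(d, a)}

/-- The edges of the 5-cycle `abcde`. -/
def pentEdges (a b c d e : V) : Set (Sym2 V) := {s(a, b), s(b, c), s(c, d), s(d, e), s(e, a)}

theorem isCycleOn_tri {u v w : V} (h₁ : G.Adj u v) (h₂ : G.Adj v w) (h₃ : G.Adj w u) :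
    IsCycleOn G (triEdges u v w) {u, v, w} := by
  have n₁ := h₁.ne
  have n₂ := h₂.ne
  have n₃ := h₃.ne
  refine ⟨⟨u, by simp⟩, ?_, ?_, ?_⟩
  · intro x hx
    simp only [mem_insert, mem_singleton] at hx
    rcases hx with rfl | rfl | rfl
    · refine ⟨v, w, n₂, h₁, h₃.symm, fun z => ?_⟩
      simp only [triEdges, Set.mem_insert_iff, Set.mem_singleton_iff, Sym2.eq_iff]
      grind
    · refine ⟨w, u, n₃, h₂, h₁.symm, fun z => ?_⟩
      simp only [triEdges, Set.mem_insert_iff, Set.mem_singleton_iff, Sym2.eq_iff]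
      grind
    · refine ⟨u, v, n₁, h₃, h₂.symm, fun z => ?_⟩
      simp only [triEdges, Set.mem_insert_iff, Set.mem_singleton_iff, Sym2.eq_iff]
      grind
  · intro x hx z
    simp only [triEdges, Set.mem_insert_iff, Set.mem_singleton_iff, Sym2.eq_iff]
    simp only [mem_insert, mem_singleton] at hx
    grind
  · intro f hf
    have k₁ := hf u w v (by simp [triEdges, Sym2.eq_swap]) (by simp [triEdges])
    have k₂ := hf v u w (by simp [triEdges, Sym2.eq_swap]) (by simp [triEdges])
    have k₃ := hf w v u (by simp [triEdges, Sym2.eq_swap]) (by simp [triEdges])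
    rw [Sym2.eq_swap (a := u) (b := w)] at k₁
    rw [Sym2.eq_swap (a := v) (b := u)] at k₂
    rw [Sym2.eq_swap (a := w) (b := v)] at k₃
    intro e he e' he'
    simp only [triEdges, Set.mem_insert_iff, Set.mem_singleton_iff] at he he'
    rcases he with rfl | rfl | rfl <;> rcases he' with rfl | rfl | rfl <;> tauto

theorem isCycleOn_quad {a b c d : V} (h₁ : G.Adj a b) (h₂ : G.Adj b c) (h₃ : G.Adj c d)
    (h₄ : G.Adj d a) (hac : a ≠ c) (hbd : b ≠ d) :
    IsCycleOn G (quadEdges a b c d) {a, b, c, d} := by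
  have n₁ := h₁.ne
  have n₂ := h₂.ne
  have n₃ := h₃.ne
  have n₄ := h₄.ne
  refine ⟨⟨a, by simp⟩, ?_, ?_, ?_⟩
  · intro x hx
    simp only [mem_insert, mem_singleton] at hx
    rcases hx with rfl | rfl | rfl | rfl
    · refine ⟨b, d, hbd, h₁, h₄.symm, fun z => ?_⟩
      simp only [quadEdges, Set.mem_insert_iff, Set.mem_singleton_iff, Sym2.eq_iff]
      grind
    · refine ⟨c, a, hac.symm, h₂, h₁.symm, fun z => ?_⟩
      simp only [quadEdges, Set.mem_insert_iff, Set.mem_singleton_iff, Sym2.eq_iff]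
      grind
    · refine ⟨d, b, hbd.symm, h₃, h₂.symm, fun z => ?_⟩
      simp only [quadEdges, Set.mem_insert_iff, Set.mem_singleton_iff, Sym2.eq_iff]
      grind
    · refine ⟨a, c, hac, h₄, h₃.symm, fun z => ?_⟩
      simp only [quadEdges, Set.mem_insert_iff, Set.mem_singleton_iff, Sym2.eq_iff]
      grind
  · intro x hx z
    simp only [quadEdges, Set.mem_insert_iff, Set.mem_singleton_iff, Sym2.eq_iff]
    simp only [mem_insert, mem_singleton] at hx
    grind
  · intro f hf
    have k₁ := hf a d b (by simp [quadEdges, Sym2.eq_swap]) (by simp [quadEdges])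
    have k₂ := hf b a c (by simp [quadEdges, Sym2.eq_swap]) (by simp [quadEdges])
    have k₃ := hf c b d (by simp [quadEdges, Sym2.eq_swap]) (by simp [quadEdges])
    have k₄ := hf d c a (by simp [quadEdges, Sym2.eq_swap]) (by simp [quadEdges])
    rw [Sym2.eq_swap (a := a) (b := d)] at k₁
    rw [Sym2.eq_swap (a := b) (b := a)] at k₂
    rw [Sym2.eq_swap (a := c) (b := b)] at k₃
    rw [Sym2.eq_swap (a := d) (b := c)] at k₄
    intro e he e' he'
    simp only [quadEdges, Set.mem_insert_iff, Set.mem_singleton_iff] at he he'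
    rcases he with rfl | rfl | rfl | rfl <;> rcases he' with rfl | rfl | rfl | rfl <;> tauto

end Cycles

namespace PlaneEmbedding

variable {V : Type*} [Fintype V] {G : SimpleGraph V} (M : PlaneEmbedding G)

theorem exists_isBoundary_tri {u v w : V} (h₁ : G.Adj u v) (h₂ : G.Adj v w) (h₃ : G.Adj w u) :
    ∃ R : Set M.Face, M.IsBoundary R (triEdges u v w) := by
  obtain ⟨R, hR⟩ := M.exists_isBoundary
    (SimpleGraph.Walk.cons h₁ (.cons h₂ (.cons h₃ .nil))) (by
      have := h₁.ne
      have := h₂.ne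
      have := h₃.ne
      simp
      grind)
  refine ⟨R, fun d => ?_⟩
  rw [← hR d]
  simp [triEdges]

theorem exists_isBoundary_quad {a b c d : V} (h₁ : G.Adj a b) (h₂ : G.Adj b c) (h₃ : G.Adj c d)
    (h₄ : G.Adj d a) (hac : a ≠ c) (hbd : b ≠ d) :
    ∃ R : Set M.Face, M.IsBoundary R (quadEdges a b c d) := by
  obtain ⟨R, hR⟩ := M.exists_isBoundary
    (SimpleGraph.Walk.cons h₁ (.cons h₂ (.cons h₃ (.cons h₄ .nil)))) (by
      have := h₁.ne
      have := h₂.ne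
      have := h₃.ne
      have := h₄.ne
      simp
      grind)
  refine ⟨R, fun d => ?_⟩
  rw [← hR d]
  simp [quadEdges]

theorem exists_isBoundary_pent {a b c d e : V} (h₁ : G.Adj a b) (h₂ : G.Adj b c) (h₃ : G.Adj c d)
    (h₄ : G.Adj d e) (h₅ : G.Adj e a) (hac : a ≠ c) (had : a ≠ d) (hbd : b ≠ d) (hbe : b ≠ e)
    (hce : c ≠ e) :
    ∃ R : Set M.Face, M.IsBoundary R (pentEdges a b c d e) := by
  obtain ⟨R, hR⟩ := M.exists_isBoundary
    (SimpleGraph.Walk.cons h₁ (.cons h₂ (.cons h₃ (.cons h₄ (.cons h₅ .nil))))) (by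
      have := h₁.ne
      have := h₂.ne
      have := h₃.ne
      have := h₄.ne
      have := h₅.ne
      simp
      grind)
  refine ⟨R, fun d => ?_⟩
  rw [← hR d]
  simp [pentEdges]

end PlaneEmbedding

namespace RotationSystem

variable {V : Type*} {G : SimpleGraph V} {M : RotationSystem G}

/-- One of the sides of the edge `e` belongs to `R`. -/
def EdgeMeets (M : RotationSystem G) (R : Set M.Face) (e : Sym2 V) : Prop :=
  ∃ d : G.Dart, d.edge = e ∧ M.face d ∈ R

theorem EdgeMeets.of_dart {R : Set M.Face} {d : G.Dart}
    (h : M.face d ∈ R ∨ M.face d.symm ∈ R) : M.EdgeMeets R s(d.fst, d.snd) :=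
  h.elim (fun h => ⟨d, rfl, h⟩) fun h => ⟨d.symm, d.edge_symm, h⟩

theorem IsBoundary.edgeMeets {R : Set M.Face} {B : Set (Sym2 V)} (h : M.IsBoundary R B) {u v : V}
    (huv : G.Adj u v) (hB : s(u, v) ∈ B) : M.EdgeMeets R s(u, v) := by
  refine EdgeMeets.of_dart (d := ⟨(u, v), huv⟩) ?_
  have := (h ⟨(u, v), huv⟩).1 hB
  tauto

theorem Inside.edgeMeets {R : Set M.Face} {u v : V} (h : M.Inside R u) (huv : G.Adj u v) :
    M.EdgeMeets R s(u, v) := ⟨⟨(u, v), huv⟩, rfl, h _ rfl⟩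

theorem Inside.edgeMeets' {R : Set M.Face} {u v : V} (h : M.Inside R v) (huv : G.Adj u v) :
    M.EdgeMeets R s(u, v) := ⟨⟨(u, v), huv⟩, rfl, (Inside.face_symm_mem' h).1⟩

/-- No edge of `B'` has both sides in `Rᶜ`, so the connected set `Rᶜ` lies on one side of `B'`, and
the other side is contained in `R`. -/
theorem IsBoundary.exists_subset {R R₀ : Set M.Face} {B' : Set (Sym2 V)}
    (hR : M.FaceConnected Rᶜ) (h₀ : M.IsBoundary R₀ B') (hB : ∀ e ∈ B', M.EdgeMeets R e) :
    ∃ R' ⊆ R, M.IsBoundary R' B' := by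
  have := hR (Rᶜ ∩ R₀) Set.inter_subset_left (by
    intro d h1 h2
    have h3 : d.edge ∉ B' := by
      intro h
      obtain ⟨d', hd', hf⟩ := hB _ h
      rcases (SimpleGraph.dart_edge_eq_iff d' d).1 hd' with rfl | rfl
      exacts [h1 hf, h2 hf]
    have h4 := (h₀ d).not.1 h3
    simp only [Set.mem_inter_iff]
    tauto)
  rcases this with h | h
  · refine ⟨R₀, fun f hf => ?_, h₀⟩
    by_contra hfR
    exact (Set.eq_empty_iff_forall_notMem.1 h) f ⟨hfR, hf⟩
  · refine ⟨R₀ᶜ, fun f hf => ?_, h₀.compl⟩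
    by_contra hfR
    have : f ∈ Rᶜ ∩ R₀ := by rw [h]; exact hfR
    exact hf this.2

/-- If the face of `d` lies in `R`, and `d` and the preceding dart at its origin both end in
`{u, v}`, then edges meeting `R` lead from this origin to both `u` and `v`. -/
theorem turn_spec (h5 : ∀ d, M.FaceBoundedByCycle 5 d) {R : Set M.Face} {u v : V} {d : G.Dart}
    (h₁ : M.face d ∈ R) (h₃ : d.snd ∈ ({u, v} : Set V))
    (h₄ : (M.next.symm d).snd ∈ ({u, v} : Set V)) :
    ∀ x ∈ ({u, v} : Set V), ∃ e : G.Dart, e.fst = d.fst ∧ e.snd = x ∧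
      (M.face e ∈ R ∨ M.face e.symm ∈ R) := by
  set e := M.next.symm d with he
  have hd : M.next e = d := Equiv.apply_symm_apply _ _
  have hfst : e.fst = d.fst := by rw [← hd, M.next_fst]
  have hface : M.face e.symm ∈ R := by rw [← M.face_next, hd]; exact h₁
  have hne : e.snd ≠ d.snd := by
    intro h
    refine next_ne h5 e ?_
    rw [hd]
    exact SimpleGraph.Dart.toProd_injective (Prod.ext hfst.symm h.symm)
  simp only [Set.mem_insert_iff, Set.mem_singleton_iff] at h₃ h₄ ⊢
  intro x hx
  by_cases hxd : d.snd = x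
  · exact ⟨d, rfl, hxd, Or.inl h₁⟩
  · refine ⟨e, hfst, ?_, Or.inr hface⟩
    grind

/-- At most one dart with its face in `R` joins two vertices that are adjacent on the
boundary. -/
theorem IsBoundary.card_joining_le_one [Fintype G.Dart] {R : Set M.Face} {B : Set (Sym2 V)}
    (h : M.IsBoundary R B) {u v : V} (huv : s(u, v) ∈ B) :
    #{d : G.Dart | M.face d ∈ R ∧ d.fst ∈ ({u, v} : Set V) ∧ d.snd ∈ ({u, v} : Set V)} ≤ 1 := by
  rw [card_le_one]
  have hedge : ∀ d : G.Dart, d.fst ∈ ({u, v} : Set V) → d.snd ∈ ({u, v} : Set V) →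
      d.edge = s(u, v) := by
    rintro ⟨⟨a, b⟩, hab⟩ h1 h2
    have := hab.ne
    simp only [Set.mem_insert_iff, Set.mem_singleton_iff] at h1 h2
    change s(a, b) = s(u, v)
    rw [Sym2.eq_iff]
    grind
  intro d hd d' hd'
  simp only [mem_filter, mem_univ, true_and] at hd hd'
  have e1 := hedge d hd.2.1 hd.2.2
  have e2 := hedge d' hd'.2.1 hd'.2.2
  rcases (SimpleGraph.dart_edge_eq_iff d d').1 (e1.trans e2.symm) with h' | h'
  · exact h'
  · exfalso
    rw [h'] at hd
    exact ((h d').1 (e2 ▸ huv)).1 hd'.1 hd.1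

/-- Turns at boundary vertices whose edges to the special vertices lie on the boundary. -/
theorem IsBoundary.card_turns_le [Fintype V] [Fintype G.Dart]
    {R : Set M.Face} {B : Set (Sym2 V)} {P : Finset V} (h : M.IsBoundary R B)
    (hB : IsCycleOn G B P) {u v : V} {Q : Finset V} (hQ : Q ⊆ P)
    (hQB : ∀ q ∈ Q, s(q, u) ∈ B ∧ s(q, v) ∈ B)
    (hall : ∀ d : G.Dart, M.face d ∈ R → d.fst ∉ ({u, v} : Set V) → d.snd ∈ ({u, v} : Set V) →
      (M.next.symm d).snd ∈ ({u, v} : Set V) → d.fst ∈ Q) :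
    #{d : G.Dart | M.face d ∈ R ∧ d.fst ∉ ({u, v} : Set V) ∧ d.snd ∈ ({u, v} : Set V) ∧
      (M.next.symm d).snd ∈ ({u, v} : Set V)} ≤ #Q := by
  refine card_le_card_of_injOn (fun d => d.fst) ?_ ?_
  · intro d hd
    simp only [coe_filter, mem_univ, true_and, Set.mem_ofPred_eq] at hd
    exact hall d hd.1 hd.2.1 hd.2.2.1 hd.2.2.2
  · intro d hd d' hd' heq
    simp only [coe_filter, mem_univ, true_and, Set.mem_ofPred_eq] at hd hd'
    -- A turn at `q ∈ Q` is taken by a dart along the boundary with its face in `R`; there is only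
    -- one such dart at `q`.
    have key : ∀ d : G.Dart, M.face d ∈ R → d.fst ∈ Q → d.snd ∈ ({u, v} : Set V) →
        M.face d.symm ∉ R := by
      intro d h1 h2 h3
      refine ((h d).1 ?_).1 h1
      change s(d.fst, d.snd) ∈ B
      simp only [Set.mem_insert_iff, Set.mem_singleton_iff] at h3
      rcases h3 with h3 | h3 <;> rw [h3]
      exacts [(hQB _ h2).1, (hQB _ h2).2]
    have hdQ := hall d hd.1 hd.2.1 hd.2.2.1 hd.2.2.2
    have hdQ' := hall d' hd'.1 hd'.2.1 hd'.2.2.1 hd'.2.2.2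
    exact (h.existsUnique_dart hB (hQ hdQ)).unique ⟨rfl, hd.1, key d hd.1 hdQ hd.2.2.1⟩
      ⟨heq.symm, hd'.1, key d' hd'.1 hdQ' hd'.2.2.1⟩

theorem IsBoundary.inside_or_mem [Fintype V] {R : Set M.Face} {B : Set (Sym2 V)} {P : Finset V}
    (h : M.IsBoundary R B) (hB : IsCycleOn G B P) {d : G.Dart} (hd : M.face d ∈ R) :
    M.Inside R d.fst ∨ d.fst ∈ P := by
  by_cases hP : d.fst ∈ P
  · exact Or.inr hP
  · exact Or.inl ((h.inside_or (hB.off _ hP)).resolve_right fun h' => h' d rfl hd)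

end RotationSystem

namespace PlaneEmbedding

variable {V : Type*} [Fintype V] {G : SimpleGraph V} (M : PlaneEmbedding G)

open RotationSystem

/-- Both bounds estimate the corners at `u` and `v` from `card_inside_add_two_le`: each face has at
most one corner at each vertex, and `card_special_le` controls the faces that meet both. -/
theorem card_inside_le [Fintype G.Dart] [Fintype M.Face] (h5 : M.IsPentagulation) {R : Set M.Face}
    {B : Set (Sym2 V)} {P : Finset V} (h : M.IsBoundary R B) (hB : IsCycleOn G B P) {u v : V}
    (hu : u ∈ P) (hv : v ∈ P) (huv : u ≠ v) (hdom : ∀ z, M.Inside R z → G.Adj u z ∨ G.Adj v z) :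
    #{z : V | M.Inside R z} + 2 ≤ 2 * #{f : M.Face | f ∈ R} ∧
    #{z : V | M.Inside R z} + 2 ≤ #{f : M.Face | f ∈ R} +
      #{d : G.Dart | M.face d ∈ R ∧ d.fst ∈ ({u, v} : Set V) ∧ d.snd ∈ ({u, v} : Set V)} +
      #{d : G.Dart | M.face d ∈ R ∧ d.fst ∉ ({u, v} : Set V) ∧ d.snd ∈ ({u, v} : Set V) ∧
        (M.next.symm d).snd ∈ ({u, v} : Set V)} := by
  have e1 := M.card_inside_add_two_le h hB hu hv huv hdom
  have e3 : #{d : G.Dart | M.face d ∈ R ∧ d.fst ∈ ({u, v} : Set V)} ≤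
      #{d : G.Dart | M.face d ∈ R ∧ d.fst = u} + #{d : G.Dart | M.face d ∈ R ∧ d.fst = v} := by
    refine le_trans (card_le_card ?_) (card_union_le _ _)
    intro d
    simp only [Set.mem_insert_iff, Set.mem_singleton_iff, mem_filter, mem_univ, true_and, mem_union]
    tauto
  have e4 := card_corners_le (by norm_num) h5 R u
  have e5 := card_corners_le (by norm_num) h5 R v
  refine ⟨by omega, Nat.le_trans e1 ?_⟩
  convert card_special_le h5 R {u, v}

theorem exists_subset_tri {R : Set M.Face} {B : Set (Sym2 V)} {P : Finset V}
    (h : M.IsBoundary R B) (hB : IsCycleOn G B P) {u v w : V} (huv : G.Adj u v)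
    (hvw : G.Adj v w) (hwu : G.Adj w u) (h₁ : M.EdgeMeets R s(u, v)) (h₂ : M.EdgeMeets R s(v, w))
    (h₃ : M.EdgeMeets R s(w, u)) : ∃ R' ⊆ R, M.IsBoundary R' (triEdges u v w) := by
  obtain ⟨R₀, h₀⟩ := M.exists_isBoundary_tri huv hvw hwu
  refine IsBoundary.exists_subset (h.compl.faceConnected M.connected hB) h₀ ?_
  rintro e (rfl | rfl | rfl) <;> assumption

/-- A side of a triangle is not dominated by two of its vertices. -/
theorem not_dominated_tri (h5 : M.IsPentagulation) {u v w : V} (huv : G.Adj u v)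
    (hvw : G.Adj v w) (hwu : G.Adj w u) {R : Set M.Face} (h : M.IsBoundary R (triEdges u v w))
    (hdom : ∀ z, M.Inside R z → G.Adj u z ∨ G.Adj v z) : False := by
  let _ : Fintype G.Dart := Fintype.ofFinite _
  let _ : Fintype M.Face := Fintype.ofFinite _
  induction hn : R.ncard using Nat.strong_induction_on generalizing R w with
  | _ n ih =>
  have hB := isCycleOn_tri huv hvw hwu
  -- A common neighbour inside gives a triangle on `uv` with a smaller side that is still dominated.
  -- Without one, `w` is the only possible turn.
  by_cases ht : ∃ t, M.Inside R t ∧ G.Adj v t ∧ G.Adj t u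
  · obtain ⟨t, htR, hvt, htu⟩ := ht
    obtain ⟨R', hR', h'⟩ := M.exists_subset_tri h hB huv hvt htu
      (h.edgeMeets huv (by simp [triEdges])) (htR.edgeMeets' hvt) (htR.edgeMeets htu)
    refine ih R'.ncard ?_ hvt htu h' (fun z hz => hdom z (hz.mono hR')) rfl
    rw [← hn]
    refine Set.ncard_lt_ncard (hR'.ssubset_of_ne ?_) (Set.toFinite _)
    rintro rfl
    exact h'.not_inside htu (by simp [triEdges]) htR
  · push Not at ht
    have e1 := M.region_count h5 h hB
    have e2 := M.card_inside_le h5 h hB (u := u) (v := v) (by simp) (by simp) huv.ne hdom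
    have e3 := h.card_joining_le_one (u := u) (v := v) (by simp [triEdges])
    have e4 := h.card_turns_le hB (u := u) (v := v) (Q := {w}) (by simp)
      (by simp [triEdges, Sym2.eq_swap]) (by
        intro d h1 h2 h3 h4
        have hs := turn_spec h5 h1 h3 h4
        obtain ⟨⟨⟨_, _⟩, e⟩, rfl, rfl, -⟩ := hs v (by simp)
        obtain ⟨⟨⟨_, _⟩, e'⟩, hx, rfl, -⟩ := hs u (by simp)
        have hx : _ = d.fst := hx
        subst hx
        rcases h.inside_or_mem hB h1 with hin | hin
        · exact absurd e' (ht _ hin e.symm)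
        · simp only [mem_insert, mem_singleton] at hin ⊢
          simp only [Set.mem_insert_iff, Set.mem_singleton_iff] at h2
          tauto)
    rw [card_singleton] at e4
    -- With `f` faces and `i` inner vertices: `3f = 2i + 1`, `i ≤ f` and `i + 2 ≤ 2f`, which is
    -- impossible.
    have e5 : #({u, v, w} : Finset V) = 3 := card_eq_three.2
      ⟨u, v, w, huv.ne, hwu.ne.symm, hvw.ne, rfl⟩
    omega

end PlaneEmbedding

end

/-! ### Dominated sides of 4-cycles and thin paths -/

section

open Finset
open scoped Classical

/-- A path `u a b v` whose inner vertices `a` and `b` have degree two. -/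
structure IsThinPath {V : Type*} (G : SimpleGraph V) (u a b v : V) : Prop where
  ua : G.Adj u a
  ab : G.Adj a b
  bv : G.Adj b v
  nbr_a : ∀ t, G.Adj a t → t = u ∨ t = b
  nbr_b : ∀ t, G.Adj b t → t = a ∨ t = v

theorem IsThinPath.symm {V : Type*} {G : SimpleGraph V} {u a b v : V} (h : IsThinPath G u a b v) :
    IsThinPath G v b a u :=
  ⟨h.bv.symm, h.ab.symm, h.ua.symm, fun t ht => (h.nbr_b t ht).symm,
    fun t ht => (h.nbr_a t ht).symm⟩

namespace PlaneEmbedding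

variable {V : Type*} [Fintype V] {G : SimpleGraph V} (M : PlaneEmbedding G)

open RotationSystem

/-- A side of a 4-cycle is not dominated by two consecutive vertices. -/
theorem not_dominated_quad (h5 : M.IsPentagulation) {u v x y : V} (huv : G.Adj u v)
    (hvx : G.Adj v x) (hxy : G.Adj x y) (hyu : G.Adj y u) (hux : u ≠ x) (hvy : v ≠ y)
    {R : Set M.Face} (h : M.IsBoundary R (quadEdges u v x y))
    (hdom : ∀ z, M.Inside R z → G.Adj u z ∨ G.Adj v z) : False := by
  let _ : Fintype G.Dart := Fintype.ofFinite _
  let _ : Fintype M.Face := Fintype.ofFinite _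
  have hB := isCycleOn_quad huv hvx hxy hyu hux hvy
  have e1 := M.region_count h5 h hB
  have e2 := M.card_inside_le h5 h hB (u := u) (v := v) (by simp) (by simp) huv.ne hdom
  have e3 := h.card_joining_le_one (u := u) (v := v) (by simp [quadEdges])
  -- A turn would close a triangle on `uv` with a dominated side inside `R`.
  have e4 := h.card_turns_le hB (u := u) (v := v) (Q := ∅) (by simp) (by simp) (by
    intro d h1 h2 h3 h4
    exfalso
    have hs := turn_spec h5 h1 h3 h4
    obtain ⟨⟨⟨_, _⟩, e⟩, rfl, rfl, hv⟩ := hs v (by simp)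
    obtain ⟨⟨⟨_, _⟩, e'⟩, hx, rfl, hu⟩ := hs u (by simp)
    have hx : _ = d.fst := hx
    subst hx
    obtain ⟨R', hR', h'⟩ := M.exists_subset_tri h hB huv e.symm e'
      (h.edgeMeets huv (by simp [quadEdges])) (by
        rw [Sym2.eq_swap]
        exact EdgeMeets.of_dart (d := ⟨(_, _), e⟩) hv) (EdgeMeets.of_dart hu)
    exact M.not_dominated_tri h5 huv e.symm e' h' fun z hz => hdom z (hz.mono hR'))
  rw [card_empty] at e4
  -- Here `3f = 2i + 2` and `i + 1 ≤ f`, which is impossible.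
  have e5 : #({u, v, x, y} : Finset V) = 4 := by
    have := huv.ne
    have := hvx.ne
    have := hxy.ne
    have := hyu.ne
    rw [card_insert_of_notMem, card_insert_of_notMem, card_insert_of_notMem, card_singleton] <;>
      simp <;> tauto
  omega

theorem two_le_card_darts [Fintype G.Dart] (h5 : M.IsPentagulation) {a b : V} (hab : G.Adj a b) :
    2 ≤ #{d : G.Dart | d.fst = a} := by
  have hne := next_ne h5 ⟨(a, b), hab⟩
  rw [← card_pair hne]
  refine card_le_card fun d hd => ?_
  simp only [mem_insert, mem_singleton] at hd
  simp only [mem_filter, mem_univ, true_and]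
  rcases hd with rfl | rfl
  exacts [M.next_fst _, rfl]

/-- At least two darts leave each of `a` and `b`, and two more come from `p` and `q`. These account
for all six darts with both sides in `R`, so `a` and `b` have no further neighbours. -/
theorem exists_thinPath_aux [Fintype G.Dart] [Fintype M.Face] (h5 : M.IsPentagulation)
    {R : Set M.Face} {B : Set (Sym2 V)} {P : Finset V} (h : M.IsBoundary R B)
    (hB : IsCycleOn G B P) (hR : #{f : M.Face | f ∈ R} = 2)
    (hdarts : #{d : G.Dart | M.face d ∈ R ∧ M.face d.symm ∈ R} = 6) {a b p q : V} (hab : a ≠ b)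
    (ha : M.Inside R a) (hb : M.Inside R b) (hp : p ∈ P) (hq : q ∈ P) (hpa : G.Adj p a)
    (hqb : G.Adj q b) : IsThinPath G p a b q ∧ p ≠ q := by
  have hpR := h.not_inside_of_mem hB hp
  have hqR := h.not_inside_of_mem hB hq
  have hpa' : p ≠ a := by rintro rfl; exact hpR ha
  have hpb' : p ≠ b := by rintro rfl; exact hpR hb
  have hqa' : q ≠ a := by rintro rfl; exact hqR ha
  have hqb' : q ≠ b := by rintro rfl; exact hqR hb
  set da : G.Dart := ⟨(p, a), hpa⟩
  set db : G.Dart := ⟨(q, b), hqb⟩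
  have hda : da.fst = p := rfl
  have hdb : db.fst = q := rfl
  have hda2 : da.snd = a := rfl
  have hdb2 : db.snd = b := rfl
  have hdab : da ≠ db := fun h => hab (congrArg (fun d : G.Dart => d.snd) h)
  set A : Finset G.Dart := {d : G.Dart | d.fst = a}
  set A' : Finset G.Dart := {d : G.Dart | d.fst = b}
  have hA : 2 ≤ #A := M.two_le_card_darts h5 hpa.symm
  have hA' : 2 ≤ #A' := M.two_le_card_darts h5 hqb.symm
  set E : Finset G.Dart := {d : G.Dart | M.face d ∈ R ∧ M.face d.symm ∈ R}
  have hcard : #(A ∪ A' ∪ {da, db}) = #A + #A' + 2 := by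
    rw [card_union_of_disjoint, card_union_of_disjoint, card_pair hdab]
    · rw [disjoint_left]
      intro d h1 h2
      simp only [A, A', mem_filter, mem_univ, true_and] at h1 h2
      exact hab (h1.symm.trans h2)
    · rw [disjoint_left]
      intro d h1 h2
      simp only [A, A', mem_filter, mem_univ, true_and, mem_union, mem_insert,
        mem_singleton] at h1 h2
      rcases h2 with rfl | rfl
      · exact h1.elim hpa' hpb'
      · exact h1.elim hqa' hqb'
  have hsub : A ∪ A' ∪ {da, db} ⊆ E := by
    intro d hd
    simp only [A, A', mem_filter, mem_univ, true_and, mem_union, mem_insert,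
      mem_singleton] at hd
    simp only [E, mem_filter, mem_univ, true_and]
    rcases hd with (rfl | rfl) | rfl | rfl
    · exact ha.face_symm_mem
    · exact hb.face_symm_mem
    · exact Inside.face_symm_mem' ha
    · exact Inside.face_symm_mem' hb
  have hle := card_le_card hsub
  have hEq := eq_of_subset_of_card_le hsub (by omega)
  have hmem : ∀ d : G.Dart, M.face d ∈ R ∧ M.face d.symm ∈ R →
      d.fst = a ∨ d.fst = b ∨ d = da ∨ d = db := by
    intro d hd
    have : d ∈ A ∪ A' ∪ {da, db} := by rw [hEq]; simpa [E] using hd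
    simp only [A, A', mem_filter, mem_univ, true_and, mem_union, mem_insert,
      mem_singleton] at this
    tauto
  have hnbr_a : ∀ t, G.Adj a t → t = p ∨ t = b := by
    intro t ht
    rcases hmem ⟨(t, a), ht.symm⟩ (Inside.face_symm_mem' ha) with h' | h' | h' | h'
    · exact absurd h'.symm ht.ne
    · exact Or.inr h'
    · exact Or.inl (congrArg (fun d : G.Dart => d.fst) h')
    · exact absurd (congrArg (fun d : G.Dart => d.snd) h') hab
  have hnbr_b : ∀ t, G.Adj b t → t = a ∨ t = q := by
    intro t ht
    rcases hmem ⟨(t, b), ht.symm⟩ (Inside.face_symm_mem' hb) with h' | h' | h' | h'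
    · exact Or.inl h'
    · exact absurd h'.symm ht.ne
    · exact absurd (congrArg (fun d : G.Dart => d.snd) h').symm hab
    · exact Or.inr (congrArg (fun d : G.Dart => d.fst) h')
  have hadj : G.Adj a b := by
    by_contra hnadj
    have : #A ≤ 1 := by
      rw [card_le_one]
      have : ∀ d ∈ A, d.fst = a ∧ d.snd = p := by
        intro d hd
        have hd : d.fst = a := by simpa [A] using hd
        refine ⟨hd, (hnbr_a d.snd (hd ▸ d.adj)).resolve_right ?_⟩
        rintro rfl
        exact hnadj (hd ▸ d.adj)
      intro d hd d' hd'
      exact SimpleGraph.Dart.toProd_injective (Prod.ext ((this d hd).1.trans (this d' hd').1.symm)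
        ((this d hd).2.trans (this d' hd').2.symm))
    omega
  refine ⟨⟨hpa, hadj, hqb.symm, hnbr_a, hnbr_b⟩, ?_⟩
  · rintro rfl
    -- If both ends were `p`, there would be three corners at `p` in only two faces.
    obtain ⟨d, ⟨h1, h2, h3⟩, -⟩ := h.existsUnique_dart hB hp
    have k1 := card_corners_le (by norm_num) h5 R p
    have hdda : d ≠ da := by
      rintro rfl
      exact h3 (Inside.face_symm_mem' (d := da) ha).2
    have hddb : d ≠ db := by
      rintro rfl
      exact h3 (Inside.face_symm_mem' (d := db) hb).2
    have k2 : #{d, da, db} ≤ #{d : G.Dart | M.face d ∈ R ∧ d.fst = p} := by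
      refine card_le_card fun e he => ?_
      simp only [mem_insert, mem_singleton] at he
      simp only [mem_filter, mem_univ, true_and]
      rcases he with rfl | rfl | rfl
      · exact ⟨h2, h1⟩
      · exact ⟨(Inside.face_symm_mem' (d := da) ha).1, rfl⟩
      · exact ⟨(Inside.face_symm_mem' (d := db) hb).1, rfl⟩
    rw [card_eq_three.2 ⟨d, da, db, hdda, hddb, hdab, rfl⟩] at k2
    omega

/-- If a side of the 4-cycle `uxvy` is dominated by `{u, v}`, then it contains a thin path from `u`
to `v`. -/
theorem exists_thinPath (h5 : M.IsPentagulation) {u v x y : V} (hux : G.Adj u x)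
    (hxv : G.Adj x v) (hvy : G.Adj v y) (hyu : G.Adj y u) (huv : u ≠ v) (hxy : x ≠ y)
    {R : Set M.Face} (h : M.IsBoundary R (quadEdges u x v y))
    (hdom : ∀ z, M.Inside R z → G.Adj u z ∨ G.Adj v z) :
    ∃ a b, M.Inside R a ∧ M.Inside R b ∧ IsThinPath G u a b v := by
  let _ : Fintype G.Dart := Fintype.ofFinite _
  let _ : Fintype M.Face := Fintype.ofFinite _
  induction hn : R.ncard using Nat.strong_induction_on generalizing R y with
  | _ n ih =>
  have hB := isCycleOn_quad hux hxv hvy hyu huv hxy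
  by_cases ht : ∃ t, M.Inside R t ∧ G.Adj v t ∧ G.Adj t u
  · obtain ⟨t, htR, hvt, htu⟩ := ht
    have hxt : x ≠ t := by
      rintro rfl
      exact h.not_inside_of_mem hB (by simp) htR
    obtain ⟨R₀, h₀⟩ := M.exists_isBoundary_quad hux hxv hvt htu huv hxt
    obtain ⟨R', hR', h'⟩ := IsBoundary.exists_subset (h.compl.faceConnected M.connected hB) h₀ (by
      rintro e (rfl | rfl | rfl | rfl)
      · exact h.edgeMeets hux (by simp [quadEdges])
      · exact h.edgeMeets hxv (by simp [quadEdges])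
      · exact htR.edgeMeets' hvt
      · exact htR.edgeMeets htu)
    obtain ⟨a, b, ha, hb, hab⟩ := ih R'.ncard (by
      rw [← hn]
      refine Set.ncard_lt_ncard (hR'.ssubset_of_ne ?_) (Set.toFinite _)
      rintro rfl
      exact h'.not_inside htu (by simp [quadEdges]) htR) hvt htu hxt h'
      (fun z hz => hdom z (hz.mono hR')) rfl
    exact ⟨a, b, ha.mono hR', hb.mono hR', hab⟩
  · push Not at ht
    have e1 := M.region_count h5 h hB
    have e2 := M.card_inside_le h5 h hB (u := u) (v := v) (by simp) (by simp) huv hdom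
    -- An edge `uv` drawn in `R` would cut off a triangle `uvx` with a dominated side.
    have e3 : #{d : G.Dart | M.face d ∈ R ∧ d.fst ∈ ({u, v} : Set V) ∧
        d.snd ∈ ({u, v} : Set V)} = 0 := by
      rw [card_eq_zero, eq_empty_iff_forall_notMem]
      intro d hd
      simp only [mem_filter, mem_univ, true_and] at hd
      obtain ⟨h1, h2, h3⟩ := hd
      have hne := d.fst_ne_snd
      have hmeet := EdgeMeets.of_dart (M := M.toRotationSystem) (d := d) (Or.inl h1)
      simp only [Set.mem_insert_iff, Set.mem_singleton_iff] at h2 h3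
      have huvE : M.EdgeMeets R s(u, v) ∧ G.Adj u v := by
        have hadj := d.adj
        rcases h2 with h2 | h2 <;> rcases h3 with h3 | h3
        · exact absurd (h2.trans h3.symm) hne
        · rw [h2, h3] at hmeet hadj; exact ⟨hmeet, hadj⟩
        · rw [h2, h3] at hmeet hadj; exact ⟨Sym2.eq_swap ▸ hmeet, hadj.symm⟩
        · exact absurd (h2.trans h3.symm) hne
      obtain ⟨R', hR', h'⟩ := M.exists_subset_tri h hB huvE.2 hxv.symm hux.symm huvE.1
        (by rw [Sym2.eq_swap]; exact h.edgeMeets hxv (by simp [quadEdges]))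
        (by rw [Sym2.eq_swap]; exact h.edgeMeets hux (by simp [quadEdges]))
      exact M.not_dominated_tri h5 huvE.2 hxv.symm hux.symm h' fun z hz => hdom z (hz.mono hR')
    have e4 := h.card_turns_le hB (u := u) (v := v) (Q := {x, y})
      (by intro z; simp only [mem_insert, mem_singleton]; tauto) (by
        simp [quadEdges, Sym2.eq_swap]) (by
        intro d h1 h2 h3 h4
        have hs := turn_spec h5 h1 h3 h4
        obtain ⟨⟨⟨_, _⟩, e⟩, rfl, rfl, -⟩ := hs v (by simp)
        obtain ⟨⟨⟨_, _⟩, e'⟩, hx, rfl, -⟩ := hs u (by simp)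
        have hx : _ = d.fst := hx
        subst hx
        rcases h.inside_or_mem hB h1 with hin | hin
        · exact absurd e' (ht _ hin e.symm)
        · simp only [mem_insert, mem_singleton] at hin ⊢
          simp only [Set.mem_insert_iff, Set.mem_singleton_iff] at h2
          tauto)
    rw [card_pair hxy] at e4
    have e5 : #({u, x, v, y} : Finset V) = 4 := by
      have := hux.ne
      have := hxv.ne
      have := hvy.ne
      have := hyu.ne
      rw [card_insert_of_notMem, card_insert_of_notMem, card_insert_of_notMem, card_singleton] <;>
        simp <;> tauto
    have e6 := M.euler_region h hB
    -- `3f = 2i + 2` and `i ≤ f` leave only `f = i = 2`; Euler's formula then gives six inner darts.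
    obtain ⟨a, b, hab, heq⟩ := card_eq_two.1 (show #{z : V | M.Inside R z} = 2 by omega)
    have ha : M.Inside R a := by
      have : a ∈ ({z : V | M.Inside R z} : Finset V) := by rw [heq]; simp
      simpa using this
    have hb : M.Inside R b := by
      have : b ∈ ({z : V | M.Inside R z} : Finset V) := by rw [heq]; simp
      simpa using this
    have hau : u ∈ ({u, x, v, y} : Finset V) := by simp
    have hav : v ∈ ({u, x, v, y} : Finset V) := by simp
    have aux : ∀ {p q : V}, p ∈ ({u, x, v, y} : Finset V) → q ∈ ({u, x, v, y} : Finset V) →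
        G.Adj p a → G.Adj q b → IsThinPath G p a b q ∧ p ≠ q := fun hp hq =>
      M.exists_thinPath_aux h5 h hB (by omega) (by omega) hab ha hb hp hq
    rcases hdom a ha with h1 | h1 <;> rcases hdom b hb with h2 | h2
    · exact absurd rfl (aux hau hau h1 h2).2
    · exact ⟨a, b, ha, hb, (aux hau hav h1 h2).1⟩
    · exact ⟨b, a, hb, ha, (aux hav hau h1 h2).1.symm⟩
    · exact absurd rfl (aux hav hav h1 h2).2

end PlaneEmbedding

end

/-! ### Thin paths in diameter three; two thin paths without common end -/

section

open Finset
open scoped Classical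

section Near

variable {V : Type*} {G : SimpleGraph V}

/-- Any two vertices are at distance at most three. -/
def DistLeThree (G : SimpleGraph V) : Prop :=
  ∀ z w, z = w ∨ G.Adj z w ∨ (∃ t, G.Adj z t ∧ G.Adj t w) ∨
    ∃ s t, G.Adj z s ∧ G.Adj s t ∧ G.Adj t w

/-- A path of length at most three from `z` to `a` must enter `a` through `u` or `b`, and `b` can be
entered only through `v`, which is not adjacent to `z`. -/
theorem IsThinPath.exists_common_nbr (hG : DistLeThree G) {u a b v z : V}
    (h : IsThinPath G u a b v) (ha : z ≠ a) (hb : z ≠ b) (hu : z ≠ u) (hv : z ≠ v)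
    (hzu : ¬ G.Adj z u) (hzv : ¬ G.Adj z v) : ∃ t, G.Adj z t ∧ G.Adj t u := by
  have hza : ¬ G.Adj z a := fun h' => (h.nbr_a z h'.symm).elim hu hb
  have hzb : ¬ G.Adj z b := fun h' => (h.nbr_b z h'.symm).elim ha hv
  rcases hG z a with h1 | h1 | ⟨t, h1, h2⟩ | ⟨s, t, h1, h2, h3⟩
  · exact absurd h1 ha
  · exact absurd h1 hza
  · rcases h.nbr_a t h2.symm with rfl | rfl
    · exact absurd h1 hzu
    · exact absurd h1 hzb
  · rcases h.nbr_a t h3.symm with rfl | rfl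
    · exact ⟨s, h1, h2⟩
    · rcases h.nbr_b s h2.symm with rfl | rfl
      · exact absurd h1 hza
      · exact absurd h1 hzv

/-- As inner vertices have degree two, the only possible path of length at most three from `a` to
`a'` is `a u u' a'`. -/
theorem IsThinPath.adj_ends (hG : DistLeThree G) {u a b v u' a' b' v' : V}
    (h : IsThinPath G u a b v) (h' : IsThinPath G u' a' b' v') (huu : u ≠ u')
    (haa : a ≠ a') (hba : b ≠ a') (hbb : b ≠ b')
    (hau' : a ≠ u') (hbu' : b ≠ u')
    (hua' : u ≠ a') (hub' : u ≠ b') (hvb' : v ≠ b') (huv' : u ≠ v') (hvu' : v ≠ u')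
    (hab : a ≠ b') : G.Adj u u' := by
  rcases hG a a' with h1 | h1 | ⟨t, h1, h2⟩ | ⟨s, t, h1, h2, h3⟩
  · exact absurd h1 haa
  · exact (h.nbr_a _ h1).elim (fun e => absurd e.symm hua') (fun e => absurd e.symm hba)
  · rcases h.nbr_a _ h1 with rfl | rfl <;> rcases h'.nbr_a _ h2.symm with e | e <;>
      first | exact absurd e huu | exact absurd e hub' | exact absurd e hbu' | exact absurd e hbb
  · rcases h.nbr_a _ h1 with rfl | rfl <;> rcases h'.nbr_a _ h3.symm with rfl | rfl
    · exact h2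
    · exact (h'.nbr_b _ h2.symm).elim (fun e => absurd e hua') (fun e => absurd e huv')
    · exact (h.nbr_b _ h2).elim (fun e => absurd e.symm hau') (fun e => absurd e.symm hvu')
    · exact (h.nbr_b _ h2).elim (fun e => absurd e.symm hab) (fun e => absurd e.symm hvb')

theorem off_triEdges {u v w z : V} (hu : z ≠ u) (hv : z ≠ v) (hw : z ≠ w) (y : V) :
    s(z, y) ∉ triEdges u v w := by
  simp only [triEdges, Set.mem_insert_iff, Set.mem_singleton_iff, Sym2.eq_iff]
  tauto

theorem off_quadEdges {a b c d z : V} (ha : z ≠ a) (hb : z ≠ b) (hc : z ≠ c) (hd : z ≠ d) (y : V) :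
    s(z, y) ∉ quadEdges a b c d := by
  simp only [quadEdges, Set.mem_insert_iff, Set.mem_singleton_iff, Sym2.eq_iff]
  tauto

theorem off_pentEdges {a b c d e z : V} (ha : z ≠ a) (hb : z ≠ b) (hc : z ≠ c) (hd : z ≠ d)
    (he : z ≠ e) (y : V) : s(z, y) ∉ pentEdges a b c d e := by
  simp only [pentEdges, Set.mem_insert_iff, Set.mem_singleton_iff, Sym2.eq_iff]
  tauto

theorem quadEdges_iff_pentEdges {u a b v c c' : V} (hub : u ≠ b) (huv : u ≠ v) (hav : a ≠ v)
    (huc : u ≠ c) (huc' : u ≠ c') (hvc : v ≠ c) (hvc' : v ≠ c') (hcc : c ≠ c') (hac : a ≠ c)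
    (hac' : a ≠ c') (hbc : b ≠ c) (hbc' : b ≠ c') (hua : u ≠ a) (hbv : b ≠ v)
    (e : Sym2 V) : e ∈ quadEdges u c v c' ↔
      ¬ (e ∈ pentEdges u a b v c ↔ e ∈ pentEdges u a b v c') := by
  by_cases h1 : e = s(u, a)
  · subst h1; simp [quadEdges, pentEdges]; grind
  by_cases h2 : e = s(a, b)
  · subst h2; simp [quadEdges, pentEdges]; grind
  by_cases h3 : e = s(b, v)
  · subst h3; simp [quadEdges, pentEdges]; grind
  by_cases h4 : e = s(v, c)
  · subst h4; simp [quadEdges, pentEdges]; grind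
  by_cases h5 : e = s(c, u)
  · subst h5; simp [quadEdges, pentEdges]; grind
  by_cases h6 : e = s(v, c')
  · subst h6; simp [quadEdges, pentEdges]; grind
  by_cases h7 : e = s(c', u)
  · subst h7; simp [quadEdges, pentEdges]; grind
  rw [Sym2.eq_swap] at h4 h5
  simp only [quadEdges, pentEdges, Set.mem_insert_iff, Set.mem_singleton_iff]
  rw [Sym2.eq_swap (a := v) (b := c), Sym2.eq_swap (a := c) (b := u)]
  simp [h1, h2, h3, h4, h5, h6, h7]

end Near

namespace RotationSystem

variable {V : Type*} [Fintype V] {G : SimpleGraph V} {M : RotationSystem G}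

/-- A path of length two between the sides of a closed curve meets the curve. -/
theorem IsBoundary.exists_mem_of_path {R : Set M.Face} {B : Set (Sym2 V)} (h : M.IsBoundary R B)
    {z t w : V} (hz : M.Inside R z) (hw : M.Inside Rᶜ w) (hzt : G.Adj z t) (htw : G.Adj t w) :
    ∃ y, s(t, y) ∈ B := by
  by_contra! hcon
  rcases h.inside_or hcon with h' | h'
  · exact h'.not_adj hw htw
  · exact hz.not_adj h' hzt

theorem IsBoundary.exists_side {R : Set M.Face} {B : Set (Sym2 V)} (h : M.IsBoundary R B)
    {w : V} (hw : ∀ y, s(w, y) ∉ B) : ∃ R' : Set M.Face, M.IsBoundary R' B ∧ M.Inside R'ᶜ w := by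
  rcases h.inside_or hw with h' | h'
  · exact ⟨Rᶜ, h.compl, by rwa [compl_compl]⟩
  · exact ⟨R, h, h'⟩

/-- No edge separates the set of faces on which `R` and `R'` agree. -/
theorem IsBoundary.eq_or_compl (hc : G.Connected) {R R' : Set M.Face} {B : Set (Sym2 V)}
    (h : M.IsBoundary R B) (h' : M.IsBoundary R' B) : R = R' ∨ R = R'ᶜ := by
  have := eq_empty_or_univ hc (R := {f | f ∈ R ↔ f ∈ R'}) (by
    intro d
    have h1 := h d
    have h2 := h' d
    simp only [Set.mem_ofPred_eq]
    tauto)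
  rcases this with h1 | h1
  · right
    ext f
    have := Set.eq_empty_iff_forall_notMem.1 h1 f
    simp only [Set.mem_ofPred_eq, Set.mem_compl_iff] at this ⊢
    tauto
  · left
    ext f
    have : f ∈ {f | f ∈ R ↔ f ∈ R'} := by rw [h1]; trivial
    exact this

/-- The middle vertex of a path of length two from `z` to `w` would have to lie on the 5-cycle if
the cycle separated them, but `z` is adjacent to none of its vertices. -/
theorem thin_side {T : Set M.Face} {u a b v c w z : V} (hth : IsThinPath G u a b v)
    (h : M.IsBoundary T (pentEdges u a b v c)) (hw : M.Inside Tᶜ w)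
    (hu : z ≠ u) (ha : z ≠ a) (hb : z ≠ b) (hv : z ≠ v) (hc : z ≠ c)
    (hzu : ¬ G.Adj z u) (hzv : ¬ G.Adj z v) (hzc : ¬ G.Adj z c)
    (ht : ∃ t, G.Adj z t ∧ G.Adj t w) : M.Inside Tᶜ z := by
  refine (h.inside_or (off_pentEdges hu ha hb hv hc)).resolve_left fun hz => ?_
  obtain ⟨t, h1, h2⟩ := ht
  obtain ⟨y, hy⟩ := h.exists_mem_of_path hz hw h1 h2
  have hza : ¬ G.Adj z a := fun h' => (hth.nbr_a z h'.symm).elim hu hb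
  have hzb : ¬ G.Adj z b := fun h' => (hth.nbr_b z h'.symm).elim ha hv
  refine off_pentEdges ?_ ?_ ?_ ?_ ?_ y hy <;> rintro rfl <;> contradiction

/-- Edges at `c` avoid `T'` and edges at `c'` avoid `T`, so only the three edges of the thin path
can separate `T ∩ T'`. At `u` just one of them is left, which cannot separate alone; then the same
holds at `a` and at `b`. -/
theorem thin_sides_disjoint (hcon : G.Connected) {T T' : Set M.Face} {u a b v c c' : V}
    (hth : IsThinPath G u a b v) (hub : u ≠ b) (huv : u ≠ v)
    (h : M.IsBoundary T (pentEdges u a b v c)) (h' : M.IsBoundary T' (pentEdges u a b v c'))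
    (hc' : M.Inside Tᶜ c') (hc : M.Inside T'ᶜ c) (huc : G.Adj u c) : T ∩ T' = ∅ := by
  have key0 : ∀ d : G.Dart, d.snd = c ∨ d.snd = c' ∨ d.fst = c ∨ d.fst = c' →
      (M.face d ∈ T ∩ T' ↔ M.face d.symm ∈ T ∩ T') := by
    intro d hd
    have : (M.face d ∉ T ∧ M.face d.symm ∉ T) ∨ (M.face d ∉ T' ∧ M.face d.symm ∉ T') := by
      rcases hd with rfl | rfl | rfl | rfl
      · exact Or.inr (Inside.face_symm_mem' hc)
      · exact Or.inl (Inside.face_symm_mem' hc')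
      · exact Or.inr (Inside.face_symm_mem hc)
      · exact Or.inl (Inside.face_symm_mem hc')
    simp only [Set.mem_inter_iff]
    tauto
  have key1 : ∀ d : G.Dart, d.edge ≠ s(u, a) → d.edge ≠ s(a, b) → d.edge ≠ s(b, v) →
      (M.face d ∈ T ∩ T' ↔ M.face d.symm ∈ T ∩ T') := by
    intro d h1 h2 h3
    by_cases hd : d.snd = c ∨ d.snd = c' ∨ d.fst = c ∨ d.fst = c'
    · exact key0 d hd
    · have e1 : d.edge ∉ pentEdges u a b v c ∧ d.edge ∉ pentEdges u a b v c' := by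
        simp only [pentEdges, Set.mem_insert_iff, Set.mem_singleton_iff, h1, h2, h3, false_or]
        rcases d with ⟨⟨p, q⟩, hpq⟩
        simp only at hd
        change ¬ (s(p, q) = _ ∨ s(p, q) = _) ∧ ¬ (s(p, q) = _ ∨ s(p, q) = _)
        simp only [Sym2.eq_iff]
        grind
      have e2 := (h d).not.1 e1.1
      have e3 := (h' d).not.1 e1.2
      simp only [Set.mem_inter_iff]
      tauto
  have hedge : ∀ d d' : G.Dart, d.edge = d'.edge →
      (M.face d' ∈ T ∩ T' ↔ M.face d'.symm ∈ T ∩ T') →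
      (M.face d ∈ T ∩ T' ↔ M.face d.symm ∈ T ∩ T') := by
    intro d d' hd hd'
    rcases (SimpleGraph.dart_edge_eq_iff d d').1 hd with rfl | rfl
    · exact hd'
    · rw [SimpleGraph.Dart.symm_symm]; exact hd'.symm
  have hua := not_separating_of_unique (M := M) (R := T ∩ T') ⟨(u, a), hth.ua⟩ (by
    rintro ⟨⟨p, q⟩, hpq⟩ hp hne
    have hp : p = u := hp
    subst hp
    have hq : q ≠ a := by rintro rfl; exact hne rfl
    have hpa := hth.ua.ne
    apply key1 <;> change s(p, q) ≠ _ <;> rw [Ne, Sym2.eq_iff] <;> tauto)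
  have hab := not_separating_of_unique (M := M) (R := T ∩ T') ⟨(a, b), hth.ab⟩ (by
    rintro ⟨⟨p, q⟩, hpq⟩ hp hne
    have hp : p = a := hp
    subst hp
    rcases hth.nbr_a _ hpq with rfl | rfl
    · exact hedge _ ⟨(q, p), hth.ua⟩ Sym2.eq_swap hua
    · exact absurd rfl hne)
  have hbv := not_separating_of_unique (M := M) (R := T ∩ T') ⟨(b, v), hth.bv⟩ (by
    rintro ⟨⟨p, q⟩, hpq⟩ hp hne
    have hp : p = b := hp
    subst hp
    rcases hth.nbr_b _ hpq with rfl | rfl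
    · exact hedge _ ⟨(q, p), hth.ab⟩ Sym2.eq_swap hab
    · exact absurd rfl hne)
  refine (eq_empty_or_univ hcon (R := T ∩ T') fun d => ?_).resolve_right fun hU => ?_
  · by_cases h1 : d.edge = s(u, a)
    · exact hedge _ ⟨(u, a), hth.ua⟩ h1 hua
    by_cases h2 : d.edge = s(a, b)
    · exact hedge _ ⟨(a, b), hth.ab⟩ h2 hab
    by_cases h3 : d.edge = s(b, v)
    · exact hedge _ ⟨(b, v), hth.bv⟩ h3 hbv
    exact key1 d h1 h2 h3
  · have : M.face ⟨(c, u), huc.symm⟩ ∈ T ∩ T' := by rw [hU]; trivial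
    exact hc ⟨(c, u), huc.symm⟩ rfl this.2

end RotationSystem

namespace PlaneEmbedding

variable {V : Type*} [Fintype V] {G : SimpleGraph V} (M : PlaneEmbedding G)

open RotationSystem

/-- A thin path joining opposite vertices of the 4-cycle `ucvc'` determines a side of it, from
which certain vertices are excluded. -/
theorem exists_thin_side {u a b v c c' : V} (hth : IsThinPath G u a b v) (hub : u ≠ b)
    (huv : u ≠ v) (hav : a ≠ v) (hcc : c ≠ c') (hac : a ≠ c) (hac' : a ≠ c') (hbc : b ≠ c)
    (hbc' : b ≠ c') (huc : G.Adj u c) (hcv : G.Adj c v) (hvc' : G.Adj v c') (hcu' : G.Adj c' u) :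
    ∃ S : Set M.Face, M.IsBoundary S (quadEdges u c v c') ∧ M.Inside S a ∧
      (∀ z, z ≠ u → z ≠ a → z ≠ b → z ≠ v → z ≠ c → z ≠ c' → ¬ G.Adj z u → ¬ G.Adj z v →
        ¬ G.Adj z c → ¬ G.Adj z c' → (∃ t, G.Adj z t ∧ G.Adj t c) →
        (∃ t, G.Adj z t ∧ G.Adj t c') → M.Inside Sᶜ z) ∧
      (∀ w w', w ≠ u → w ≠ a → w ≠ b → w ≠ v → w ≠ c → w ≠ c' →
        w' ≠ u → w' ≠ a → w' ≠ b → w' ≠ v → w' ≠ c → w' ≠ c' → G.Adj w w' → G.Adj w c →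
        G.Adj w' c' → M.Inside Sᶜ w) := by
  obtain ⟨T₀, hT₀⟩ := M.exists_isBoundary_pent hth.ua hth.ab hth.bv hcv.symm huc.symm hub huv hav
    hac hbc
  obtain ⟨T, hT, hTc⟩ := hT₀.exists_side (w := c') (off_pentEdges hcu'.ne hac'.symm hbc'.symm
    hvc'.ne.symm hcc.symm)
  obtain ⟨T₀', hT₀'⟩ := M.exists_isBoundary_pent hth.ua hth.ab hth.bv hvc' hcu' hub huv hav
    hac' hbc'
  obtain ⟨T', hT', hTc'⟩ := hT₀'.exists_side (w := c) (off_pentEdges huc.ne.symm hac.symm hbc.symm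
    hcv.ne hcc)
  have hdis := thin_sides_disjoint M.connected hth hub huv hT hT' hTc hTc' huc
  have hdis' : ∀ f, ¬ (f ∈ T ∧ f ∈ T') := fun f hf =>
    Set.eq_empty_iff_forall_notMem.1 hdis f hf
  -- The two 5-cycles share the thin path, so modulo 2 their sum is the 4-cycle. The wanted side is
  -- thus `T ∪ T'`, and leaving it means leaving both `T` and `T'`.
  have hS : M.IsBoundary (T ∪ T') (quadEdges u c v c') := by
    intro d
    rw [quadEdges_iff_pentEdges hub huv hav huc.ne hcu'.ne.symm hcv.ne.symm hvc'.ne hcc hac hac' hbc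
      hbc' hth.ua.ne hth.bv.ne, hT d, hT' d]
    have h1 := hdis' (M.face d)
    have h2 := hdis' (M.face d.symm)
    simp only [Set.mem_union]
    tauto
  have hcompl : ∀ z, M.Inside Tᶜ z → M.Inside T'ᶜ z → M.Inside (T ∪ T')ᶜ z := by
    intro z h1 h2 d hd
    rw [Set.compl_union]
    exact ⟨h1 d hd, h2 d hd⟩
  refine ⟨T ∪ T', hS, ?_, ?_, ?_⟩
  · refine (hS.inside_or (off_quadEdges hth.ua.ne.symm hac hav hac')).resolve_right fun h' => ?_
    have h1 := h'.face_symm_mem (d := ⟨(a, b), hth.ab⟩)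
    have h2 := (hT ⟨(a, b), hth.ab⟩).1 (by
      change s(a, b) ∈ _
      simp [pentEdges])
    rw [Set.compl_union] at h1
    have h3 := h1.1.1
    have h4 := h1.2.1
    simp only [Set.mem_compl_iff] at h3 h4
    tauto
  · intro z h1 h2 h3 h4 h5 h6 h7 h8 h9 h10 h11 h12
    exact hcompl z (thin_side hth hT hTc h1 h2 h3 h4 h5 h7 h8 h9 h12)
      (thin_side hth hT' hTc' h1 h2 h3 h4 h6 h7 h8 h10 h11)
  · intro w w' h1 h2 h3 h4 h5 h6 k1 k2 k3 k4 k5 k6 hww hwc hwc'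
    refine hcompl w ?_ ?_
    · have h7 := hT.compl.inside_of_adj (off_pentEdges k1 k2 k3 k4 k5) hwc'.symm hTc
      exact hT.compl.inside_of_adj (off_pentEdges h1 h2 h3 h4 h5) hww.symm h7
    · exact hT'.compl.inside_of_adj (off_pentEdges h1 h2 h3 h4 h6) hwc.symm hTc'

theorem card_add_one_le_of_pairs [DecidableRel G.Adj] (h5 : M.IsPentagulation) {p q r s : V}
    (L : List (V × V)) (hL : L.Nodup) (hlen : L.length = 8) (hX : [p, q, r, s].Nodup)
    (hadj : ∀ e ∈ L, G.Adj e.1 e.2 ∧ e.1 ∈ [p, q, r, s] ∧ e.2 ∈ [p, q, r, s])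
    (hdom : ∀ z, z ∉ [p, q, r, s] → ∃ x ∈ [p, q, r, s], G.Adj z x) :
    Fintype.card V + 1 ≤ 3 * G.maxDegree := by
  refine M.card_add_one_le h5 [p, q, r, s].toFinset
    (by rw [List.toFinset_card_of_nodup hX]; rfl) (fun z hz => ?_) ?_
  · obtain ⟨x, hx, hzx⟩ := hdom z (by simpa using hz)
    exact ⟨x, by simpa using hx, hzx⟩
  · rw [← hlen, ← List.toFinset_card_of_nodup hL]
    refine card_le_card_of_surjOn (fun d : G.Dart => d.toProd) ?_
    intro e he
    obtain ⟨h1, h2, h3⟩ := hadj e (by simpa using he)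
    refine ⟨⟨e, h1⟩, ?_, rfl⟩
    simp only [coe_filter, mem_univ, true_and, Set.mem_ofPred_eq, List.mem_toFinset]
    exact ⟨h2, h3⟩

/-- Two thin paths whose ends form a 4-cycle. -/
theorem card_le_of_thin_paths_quad [DecidableRel G.Adj] (h5 : M.IsPentagulation)
    (hG : DistLeThree G) {u a b v u' a' b' v' : V} (hth : IsThinPath G u a b v)
    (hth' : IsThinPath G u' a' b' v') (hnd : [u, a, b, v, u', a', b', v'].Nodup)
    (h₁ : G.Adj u u') (h₂ : G.Adj u' v) (h₃ : G.Adj v v') (h₄ : G.Adj v' u) :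
    Fintype.card V + 1 ≤ 3 * G.maxDegree := by
  simp only [List.nodup_cons, List.mem_cons, List.not_mem_nil, or_false, not_or] at hnd
  obtain ⟨⟨n1, n2, n3, n4, n5, n6, n7⟩, ⟨m1, m2, m3, m4, m5, m6⟩, ⟨k1, k2, k3, k4, k5⟩,
    ⟨l1, l2, l3, l4⟩, ⟨i1, i2, i3⟩, ⟨j1, j2⟩, o1, -⟩ := hnd
  refine M.card_add_one_le_of_pairs h5 (p := u) (q := v) (r := u') (s := v')
    [(u, u'), (u', u), (u', v), (v, u'), (v, v'), (v', v), (v', u), (u, v')] ?_ rfl ?_ ?_ ?_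
  · simp; grind
  · simp; grind
  · simp [h₁, h₂, h₃, h₄, h₁.symm, h₂.symm, h₃.symm, h₄.symm]
  · intro z hz
    by_contra! hcon
    simp only [List.mem_cons, List.not_mem_nil, or_false, not_or] at hz hcon
    obtain ⟨zu, zv, zu', zv'⟩ := hz
    have au := hcon u (by simp)
    have av := hcon v (by simp)
    have au' := hcon u' (by simp)
    have av' := hcon v' (by simp)
    have za : z ≠ a := by rintro rfl; exact au hth.ua.symm
    have zb : z ≠ b := by rintro rfl; exact av hth.bv
    have za' : z ≠ a' := by rintro rfl; exact au' hth'.ua.symm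
    have zb' : z ≠ b' := by rintro rfl; exact av' hth'.bv
    have r1 := hth.exists_common_nbr hG za zb zu zv au av
    have r2 := hth.symm.exists_common_nbr hG zb za zv zu av au
    have r3 := hth'.exists_common_nbr hG za' zb' zu' zv' au' av'
    have r4 := hth'.symm.exists_common_nbr hG zb' za' zv' zu' av' au'
    obtain ⟨S, hS, hSa, hSz, -⟩ := M.exists_thin_side (c := u') (c' := v') hth n2 n3 m2 i3 m3 m6 k2
      k5 h₁ h₂ h₃ h₄
    obtain ⟨S', hS', -, hSz', hSw'⟩ := M.exists_thin_side (c := u) (c' := v) hth' i2 i3 j2 n3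
      (Ne.symm n5) (Ne.symm l2) (Ne.symm n6) (Ne.symm l3) h₁.symm h₄.symm h₃.symm h₂.symm
    have q1 := hSz z zu za zb zv zu' zv' au av au' av' r3 r4
    have q2 := hSz' z zu' za' zb' zv' zu zv au' av' au av r1 r2
    -- The first thin path lies outside `S'`, so `S` and `S'` are opposite sides of the same
    -- 4-cycle, and `z` is excluded from both.
    have q3 := hSw' a b m3 m4 m5 m6 (Ne.symm n1) m2 k2 k3 k4 k5 (Ne.symm n2) k1 hth.ab
      hth.ua.symm hth.bv
    have hQ : quadEdges u' u v' v = quadEdges u u' v v' := by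
      ext e
      simp only [quadEdges, Set.mem_insert_iff, Set.mem_singleton_iff]
      rw [Sym2.eq_swap (a := u') (b := u), Sym2.eq_swap (a := u) (b := v'),
        Sym2.eq_swap (a := v') (b := v), Sym2.eq_swap (a := v) (b := u')]
      tauto
    rw [hQ] at hS'
    rcases hS.eq_or_compl M.connected hS' with h' | h'
    · subst h'
      exact hSa.not_compl hth.ab q3
    · obtain ⟨t, ht, -⟩ := r1
      rw [h', compl_compl] at q1
      exact q1.not_compl ht q2

end PlaneEmbedding

end

/-! ### Lenses, and the two ways in which their dominating pairs can meet -/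

section

open Finset
open scoped Classical

theorem quadEdges_rev {V : Type*} (a b c d : V) : quadEdges a d c b = quadEdges a b c d := by
  ext e
  simp only [quadEdges, Set.mem_insert_iff, Set.mem_singleton_iff]
  rw [Sym2.eq_swap (a := a) (b := d), Sym2.eq_swap (a := d) (b := c),
    Sym2.eq_swap (a := c) (b := b), Sym2.eq_swap (a := b) (b := a)]
  tauto

theorem quadEdges_rotate {V : Type*} (a b c d : V) : quadEdges b c d a = quadEdges a b c d := by
  ext e
  simp only [quadEdges, Set.mem_insert_iff, Set.mem_singleton_iff]
  tauto

/-- `R` is a side of the 4-cycle `uxvy` that is dominated by the pair `{u, v}`. -/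
structure IsLens {V : Type*} {G : SimpleGraph V} (M : RotationSystem G) (R : Set M.Face)
    (u x v y : V) : Prop where
  ux : G.Adj u x
  xv : G.Adj x v
  vy : G.Adj v y
  yu : G.Adj y u
  huv : u ≠ v
  hxy : x ≠ y
  boundary : M.IsBoundary R (quadEdges u x v y)
  dom : ∀ z, M.Inside R z → G.Adj u z ∨ G.Adj v z

namespace IsLens

variable {V : Type*} {G : SimpleGraph V} {M : RotationSystem G} {R R' : Set M.Face}
  {u x v y u' x' v' y' : V}

/-- Exchanging the two vertices that do not dominate. -/
theorem flip (L : IsLens M R u x v y) : IsLens M R u y v x :=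
  ⟨L.yu.symm, L.vy.symm, L.xv.symm, L.ux.symm, L.huv, L.hxy.symm,
    by rw [quadEdges_rev]; exact L.boundary, L.dom⟩

/-- Exchanging the two dominating vertices. -/
theorem symm (L : IsLens M R u x v y) : IsLens M R v x u y :=
  ⟨L.xv.symm, L.ux.symm, L.yu.symm, L.vy.symm, L.huv.symm, L.hxy,
    by rw [← quadEdges_rev, quadEdges_rotate, quadEdges_rotate]; exact L.boundary,
    fun z hz => (L.dom z hz).symm⟩

theorem isCycleOn (L : IsLens M R u x v y) : IsCycleOn G (quadEdges u x v y) {u, x, v, y} :=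
  isCycleOn_quad L.ux L.xv L.vy L.yu L.huv L.hxy

theorem not_inside (L : IsLens M R u x v y) :
    ∀ w ∈ [u, x, v, y], ¬ M.Inside R w := fun _ hw =>
  L.boundary.not_inside_of_mem L.isCycleOn (by simpa using hw)

theorem not_inside_of_disjoint [Fintype V] (L : IsLens M R u x v y) (hR : Disjoint R R') :
    ∀ w ∈ [u, x, v, y], ¬ M.Inside R' w := by
  intro w hw hin
  obtain ⟨d, ⟨h1, h2, -⟩, -⟩ := L.boundary.existsUnique_dart L.isCycleOn (v := w)
    (by simpa using hw)
  exact Set.disjoint_left.1 hR h2 (hin d h1)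

theorem exists_thinPath [Fintype V] {M : PlaneEmbedding G} {R : Set M.Face}
    (h5 : M.IsPentagulation) (L : IsLens M.toRotationSystem R u x v y) :
    ∃ a b, M.Inside R a ∧ M.Inside R b ∧ IsThinPath G u a b v :=
  M.exists_thinPath h5 L.ux L.xv L.vy L.yu L.huv L.hxy L.boundary L.dom

/-- The vertices at distance two from `x` inside the lens are dominated by `u` and `v`. -/
theorem false_of_path [Fintype V] {M : PlaneEmbedding G} {R : Set M.Face}
    (h5 : M.IsPentagulation) (L : IsLens M.toRotationSystem R u x v y) {t z : V}
    (hxt : G.Adj x t) (ht : M.face ⟨(x, t), hxt⟩ ∈ R) (hu : t ≠ u) (hv : t ≠ v) (htz : G.Adj t z)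
    (hzu : z ≠ u) (hzx : z ≠ x) (hzv : z ≠ v) (hau : ¬ G.Adj z u) (hav : ¬ G.Adj z v) : False := by
  -- If the chord `xy` runs through the lens, then `v` is outside the part cut off with `u`, so `u`
  -- alone dominates a side of the triangle `uxy`.
  by_cases hty : t = y
  · subst hty
    obtain ⟨R', hR', h'⟩ := M.exists_subset_tri L.boundary L.isCycleOn L.ux hxt L.yu
      (L.boundary.edgeMeets L.ux (by simp [quadEdges])) ⟨_, rfl, ht⟩
      (L.boundary.edgeMeets L.yu (by simp [quadEdges]))
    have hvR' : M.Inside R'ᶜ v := (h'.inside_or (off_triEdges L.huv.symm L.xv.ne.symm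
      L.vy.ne)).resolve_left fun h => L.not_inside v (by simp) (h.mono hR')
    refine M.not_dominated_tri h5 L.ux hxt L.yu h' fun w hw => ?_
    exact (L.dom w (hw.mono hR')).imp_right fun h => absurd h.symm (hw.not_adj hvR')
  · have hoff : ∀ w, s(t, w) ∉ quadEdges u x v y := off_quadEdges hu hxt.ne.symm hv hty
    have hin : M.Inside R t := by
      refine (L.boundary.inside_or hoff).resolve_right fun h => ?_
      exact h _ (M.facePerm_fst ⟨(x, t), hxt⟩) (by rwa [M.face_facePerm])
    by_cases hzy : z = y
    · exact hau (hzy ▸ L.yu)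
    · have hz := L.boundary.inside_of_adj (off_quadEdges hzu hzx hzv hzy) htz hin
      exact (L.dom z hz).elim (fun h => hau h.symm) fun h => hav h.symm

end IsLens

theorem graphI_isContained {V : Type*} {G : SimpleGraph V} {u₁ u₂ v x₁ y₁ x₂ y₂ a₁ b₁ a₂ b₂ : V} (hux₁ : G.Adj u₁ x₁)
    (hxv₁ : G.Adj x₁ v) (hvy₁ : G.Adj v y₁) (hyu₁ : G.Adj y₁ u₁) (hux₂ : G.Adj u₂ x₂)
    (hxv₂ : G.Adj x₂ v) (hvy₂ : G.Adj v y₂) (hyu₂ : G.Adj y₂ u₂)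
    (h₁ : IsThinPath G u₁ a₁ b₁ v) (h₂ : IsThinPath G u₂ a₂ b₂ v) (huu : G.Adj u₁ u₂)
    (hnd : [u₁, x₁, v, x₂, u₂, y₂, y₁, a₁, b₁, b₂, a₂].Nodup) : graphI.IsContained G := by
  refine ⟨⟨⟨![u₁, x₁, v, x₂, u₂, y₂, y₁, a₁, b₁, b₂, a₂], ?_⟩, ?_⟩⟩
  · intro i j hij
    simp only [graphI, SimpleGraph.fromEdgeSet_adj, Set.mem_insert_iff, Set.mem_singleton_iff,
      Sym2.eq_iff] at hij
    obtain ⟨hij, -⟩ := hij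
    rcases hij with h | h | h | h | h | h | h | h | h | h | h | h | h | h | h <;>
      rcases h with ⟨rfl, rfl⟩ | ⟨rfl, rfl⟩
    exacts [hux₁, hux₁.symm, hxv₁, hxv₁.symm, hvy₁, hvy₁.symm, hyu₁, hyu₁.symm,
      hxv₂.symm, hxv₂, hux₂.symm, hux₂, hyu₂.symm, hyu₂, hvy₂.symm, hvy₂,
      h₁.ua, h₁.ua.symm, h₁.ab, h₁.ab.symm, h₁.bv, h₁.bv.symm,
      h₂.bv.symm, h₂.bv, h₂.ab.symm, h₂.ab, h₂.ua.symm, h₂.ua, huu, huu.symm]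
  · rw [← List.nodup_ofFn]
    simpa [List.ofFn_succ] using hnd

open RotationSystem

namespace PlaneEmbedding

variable {V : Type*} [Fintype V] {G : SimpleGraph V} (M : PlaneEmbedding G)

/-- An edge `u'v` would close the second thin path to a 4-cycle. On its side away from `u`, a vertex
adjacent to neither `u'` nor `v` could not have a common neighbour with `u`, so that side would be
dominated by the consecutive vertices `u'` and `v`. -/
theorem not_adj_of_thinPath (h5 : M.IsPentagulation) (hG : DistLeThree G) {u a b v u' a' b' : V}
    (hth : IsThinPath G u a b v) (hth' : IsThinPath G u' a' b' v)
    (hnd : [u, a, b, v, u', a', b'].Nodup) : ¬ G.Adj u' v := by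
  intro hadj
  simp only [List.nodup_cons, List.mem_cons, List.not_mem_nil, or_false, not_or] at hnd
  obtain ⟨⟨n1, n2, n3, n4, n5, n6⟩, ⟨m1, m2, m3, m4, m5⟩, ⟨k1, k2, k3, k4⟩,
    ⟨l1, l2, l3⟩, ⟨i1, i2⟩, j1, -⟩ := hnd
  obtain ⟨Y₀, hY₀⟩ := M.exists_isBoundary_quad hadj hth'.bv.symm hth'.ab.symm hth'.ua.symm i2 l2
  obtain ⟨Y, hY, hYu⟩ := hY₀.exists_side (w := u) (off_quadEdges n4 n3 n6 n5)
  refine M.not_dominated_quad h5 hadj hth'.bv.symm hth'.ab.symm hth'.ua.symm i2 l2 hY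
    fun z hz => ?_
  by_contra! hcon
  have hB := isCycleOn_quad hadj hth'.bv.symm hth'.ab.symm hth'.ua.symm i2 l2
  have hmem : ∀ w ∈ ({u', v, b', a'} : Finset V), z ≠ w := by
    rintro w hw rfl
    exact hY.not_inside_of_mem hB hw hz
  simp only [mem_insert, mem_singleton, forall_eq_or_imp, forall_eq] at hmem
  obtain ⟨z1, z2, z3, z4⟩ := hmem
  have hYa := hY.compl.inside_of_adj (off_quadEdges m3 m2 m5 m4) hth.ua hYu
  have hYb := hY.compl.inside_of_adj (off_quadEdges k2 k1 k4 k3) hth.ab hYa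
  have hne : ∀ {w w'}, G.Adj w w' → M.Inside Yᶜ w → z ≠ w := by
    rintro w w' hww hw rfl
    exact hz.not_compl hww hw
  obtain ⟨t, h1, h2⟩ := hth.exists_common_nbr hG (hne hth.ab hYa) (hne hth.bv hYb)
    (hne hth.ua hYu) z2 (hz.not_adj hYu) fun h => hcon.2 h.symm
  obtain ⟨w, hw⟩ := hY.exists_mem_of_path hz hYu h1 h2
  refine off_quadEdges ?_ ?_ ?_ ?_ w hw <;> rintro rfl
  · exact hcon.1 h1.symm
  · exact hcon.2 h1.symm
  · exact (hth'.nbr_b z h1.symm).elim z4 z2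
  · exact (hth'.nbr_a z h1.symm).elim z1 z3

/-- The set `{u₁, u₂, v, x}` spans the edges `u₁u₂`, `u₁x`, `u₂x` and `vx`. A vertex `z` that it
does not dominate is refuted by means of the triangle `u₁u₂x`. -/
theorem card_le_of_lenses_common [DecidableRel G.Adj] (h5 : M.IsPentagulation)
    (hG : DistLeThree G) {R₁ R₂ : Set M.Face} {u₁ u₂ v x y₁ y₂ a₁ b₁ : V}
    (L₁ : IsLens M.toRotationSystem R₁ u₁ x v y₁) (L₂ : IsLens M.toRotationSystem R₂ u₂ x v y₂)
    (hdis : Disjoint R₁ R₂) (h₁ : IsThinPath G u₁ a₁ b₁ v) (huu : G.Adj u₁ u₂) :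
    Fintype.card V + 1 ≤ 3 * G.maxDegree := by
  have hu₁v := L₁.huv
  have hu₂v := L₂.huv
  have hu₁x := L₁.ux.ne
  have hu₂x := L₂.ux.ne
  have hvx := L₁.xv.ne
  refine M.card_add_one_le_of_pairs h5 (p := u₁) (q := u₂) (r := v) (s := x)
    [(u₁, u₂), (u₂, u₁), (u₁, x), (x, u₁), (u₂, x), (x, u₂), (v, x), (x, v)] ?_ rfl ?_ ?_ ?_
  · have := huu.ne
    simp; grind
  · have := huu.ne
    simp; grind
  · simp [huu, huu.symm, L₁.ux, L₁.ux.symm, L₂.ux, L₂.ux.symm, L₁.xv, L₁.xv.symm]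
  intro z hz
  by_contra! hcon
  simp only [List.mem_cons, List.not_mem_nil, or_false, not_or] at hz hcon
  obtain ⟨zu₁, zu₂, zv, zx⟩ := hz
  have au₁ := hcon u₁ (by simp)
  have au₂ := hcon u₂ (by simp)
  have av := hcon v (by simp)
  have ax := hcon x (by simp)
  obtain ⟨W₀, hW₀⟩ := M.exists_isBoundary_tri huu L₂.ux L₁.ux.symm
  obtain ⟨W, hW, hWv⟩ := hW₀.exists_side (w := v) (off_triEdges hu₁v.symm hu₂v.symm hvx.symm)
  have htri : ∀ {t w}, s(t, w) ∈ triEdges u₁ u₂ x → t = u₁ ∨ t = u₂ ∨ t = x := by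
    intro t w htw
    by_contra! hn
    exact off_triEdges hn.1 hn.2.1 hn.2.2 w htw
  have za₁ : z ≠ a₁ := by rintro rfl; exact au₁ h₁.ua.symm
  have zb₁ : z ≠ b₁ := by rintro rfl; exact av h₁.bv
  -- By the thin path, `z` and `v` have a common neighbour, and it is not on the triangle.
  have hzW : M.Inside Wᶜ z := by
    refine (hW.inside_or (off_triEdges zu₁ zu₂ zx)).resolve_left fun hz => ?_
    obtain ⟨t, ht1, ht2⟩ := h₁.symm.exists_common_nbr hG zb₁ za₁ zv zu₁ av au₁
    obtain ⟨w, hw⟩ := hW.exists_mem_of_path hz hWv ht1 ht2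
    rcases htri hw with rfl | rfl | rfl <;> contradiction
  have hz' : ∃ z', M.Inside W z' ∧ ¬ G.Adj u₁ z' ∧ ¬ G.Adj u₂ z' := by
    by_contra! hn
    refine M.not_dominated_tri h5 huu L₂.ux L₁.ux.symm hW fun w hw => ?_
    by_contra! hn'
    exact hn'.2 (hn w hw hn'.1)
  obtain ⟨z', hz'W, z'u₁, z'u₂⟩ := hz'
  -- Of all paths of length at most three from `z'` to `z`, only `z' x t z` can cross the triangle.
  have key : ∃ t, G.Adj x t ∧ G.Adj t z ∧ ¬ M.Inside W t := by
    rcases hG z' z with rfl | h1 | ⟨t, h1, h2⟩ | ⟨s, t, h1, h2, h3⟩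
    · obtain ⟨t, ht, -⟩ := h₁.symm.exists_common_nbr hG zb₁ za₁ zv zu₁ av au₁
      exact absurd hzW (hz'W.not_compl ht)
    · exact absurd h1 (hz'W.not_adj hzW)
    · obtain ⟨w, hw⟩ := hW.exists_mem_of_path hz'W hzW h1 h2
      rcases htri hw with rfl | rfl | rfl
      exacts [absurd h2.symm au₁, absurd h2.symm au₂, absurd h2.symm ax]
    · have htW : ¬ M.Inside W t := fun h => h.not_adj hzW h3
      by_cases hsW : M.Inside W s
      · have ht' : ∃ w, s(t, w) ∈ triEdges u₁ u₂ x := by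
          by_contra! hn
          exact htW (hW.inside_of_adj hn h2 hsW)
        obtain ⟨w, hw⟩ := ht'
        rcases htri hw with rfl | rfl | rfl
        exacts [absurd h3.symm au₁, absurd h3.symm au₂, absurd h3.symm ax]
      · have hs' : ∃ w, s(s, w) ∈ triEdges u₁ u₂ x := by
          by_contra! hn
          exact hsW (hW.inside_of_adj hn h1 hz'W)
        obtain ⟨w, hw⟩ := hs'
        rcases htri hw with rfl | rfl | rfl
        exacts [absurd h1.symm z'u₁, absurd h1.symm z'u₂, ⟨t, h2, h3, htW⟩]
  obtain ⟨t, hxt, htz, htW⟩ := key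
  have tu₁ : t ≠ u₁ := by rintro rfl; exact au₁ htz.symm
  have tu₂ : t ≠ u₂ := by rintro rfl; exact au₂ htz.symm
  have tv : t ≠ v := by rintro rfl; exact av htz.symm
  -- The set consists of the faces in an odd number of `R₁`, `R₂`, `W`. At `x` the three boundaries
  -- use `xu₁, xv`, then `xu₂, xv`, then `xu₁, xu₂`; every edge occurs an even number of times, so
  -- none separates.
  have hparity : ∀ d : G.Dart, d.fst = x →
      (M.face d ∈ {f | (f ∈ R₁ ↔ f ∈ R₂) ↔ f ∈ W} ↔
        M.face d.symm ∈ {f | (f ∈ R₁ ↔ f ∈ R₂) ↔ f ∈ W}) := by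
    rintro ⟨⟨p, q⟩, hpq⟩ hp
    have hp : p = x := hp
    subst hp
    have k1 := L₁.boundary ⟨(p, q), hpq⟩
    have k2 := L₂.boundary ⟨(p, q), hpq⟩
    have k3 := hW ⟨(p, q), hpq⟩
    have e1 : s(p, q) ∈ quadEdges u₁ p v y₁ ↔ q = u₁ ∨ q = v := by
      have := L₁.hxy
      simp only [quadEdges, Set.mem_insert_iff, Set.mem_singleton_iff, Sym2.eq_iff]
      grind
    have e2 : s(p, q) ∈ quadEdges u₂ p v y₂ ↔ q = u₂ ∨ q = v := by
      have := L₂.hxy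
      simp only [quadEdges, Set.mem_insert_iff, Set.mem_singleton_iff, Sym2.eq_iff]
      grind
    have e3 : s(p, q) ∈ triEdges u₁ u₂ p ↔ q = u₁ ∨ q = u₂ := by
      simp only [triEdges, Set.mem_insert_iff, Set.mem_singleton_iff, Sym2.eq_iff]
      grind
    have k1 := e1.symm.trans k1
    have k2 := e2.symm.trans k2
    have k3 := e3.symm.trans k3
    have n1 : ¬ (q = u₁ ∧ q = v) := by rintro ⟨rfl, h⟩; exact hu₁v h
    have n2 : ¬ (q = u₂ ∧ q = v) := by rintro ⟨rfl, h⟩; exact hu₂v h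
    have n3 : ¬ (q = u₁ ∧ q = u₂) := by rintro ⟨rfl, h⟩; exact huu.ne h
    simp only [Set.mem_ofPred_eq]
    grind
  -- One face at `xv` lies in `R₁` only, so by parity every face at `x` lies in `R₁`, `R₂` or `W`.
  -- No position is left for the edge `xt`.
  have hd : ∃ d : G.Dart, d.fst = x ∧ M.face d ∈ R₁ ∧ M.face d ∉ W := by
    have k1 := (L₁.boundary ⟨(x, v), L₁.xv⟩).1 (by
      change s(x, v) ∈ _
      simp [quadEdges])
    have k2 := Inside.face_symm_mem' (d := ⟨(x, v), L₁.xv⟩) hWv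
    by_cases hR : M.face ⟨(x, v), L₁.xv⟩ ∈ R₁
    · exact ⟨_, rfl, hR, k2.1⟩
    · refine ⟨M.next ⟨(x, v), L₁.xv⟩, M.next_fst _, ?_, ?_⟩ <;> rw [M.face_next]
      · by_contra hR'
        exact hR (k1.2 hR')
      · exact k2.2
  obtain ⟨d, hdx, hdR, hdW⟩ := hd
  have hdR₂ := Set.disjoint_left.1 hdis hdR
  have hall := (face_mem_iff_of_fst_eq (d₁ := d) (d₂ := ⟨(x, t), hxt⟩) hdx fun e he =>
    hparity e (he.trans hdx)).1 (by
      simp only [Set.mem_ofPred_eq]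
      tauto)
  have hcases : M.face ⟨(x, t), hxt⟩ ∈ R₁ ∨ M.face ⟨(x, t), hxt⟩ ∈ R₂ ∨
      M.face ⟨(x, t), hxt⟩ ∈ W := by
    simp only [Set.mem_ofPred_eq] at hall
    tauto
  rcases hcases with h | h | h
  · exact L₁.false_of_path h5 hxt h tu₁ tv htz zu₁ zx zv au₁ av
  · exact L₂.false_of_path h5 hxt h tu₂ tv htz zu₂ zx zv au₂ av
  · refine htW ((hW.inside_or (off_triEdges tu₁ tu₂ hxt.ne.symm)).resolve_right fun h' => ?_)
    exact h' _ (M.facePerm_fst ⟨(x, t), hxt⟩) (by rwa [M.face_facePerm])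

/-- Two lenses with a common dominating vertex. -/
theorem lenses_common_vertex [DecidableRel G.Adj] (h5 : M.IsPentagulation) (hG : DistLeThree G)
    {R₁ R₂ : Set M.Face} {u₁ u₂ v x₁ y₁ x₂ y₂ : V}
    (L₁ : IsLens M.toRotationSystem R₁ u₁ x₁ v y₁) (L₂ : IsLens M.toRotationSystem R₂ u₂ x₂ v y₂)
    (hdis : Disjoint R₁ R₂) (huu : u₁ ≠ u₂) :
    graphI.IsContained G ∨ Fintype.card V + 1 ≤ 3 * G.maxDegree := by
  obtain ⟨a₁, b₁, ha₁, hb₁, h₁⟩ := L₁.exists_thinPath h5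
  obtain ⟨a₂, b₂, ha₂, hb₂, h₂⟩ := L₂.exists_thinPath h5
  have hne : ∀ w ∈ [u₁, x₁, v, y₁, u₂, x₂, v, y₂], w ≠ a₁ ∧ w ≠ b₁ ∧ w ≠ a₂ ∧ w ≠ b₂ := by
    intro w hw
    have hw : w ∈ [u₁, x₁, v, y₁] ∨ w ∈ [u₂, x₂, v, y₂] := by
      simp only [List.mem_cons, List.not_mem_nil, or_false] at hw ⊢
      tauto
    have hR₁ : ¬ M.Inside R₁ w := hw.elim (L₁.not_inside w)
      (L₂.not_inside_of_disjoint hdis.symm w)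
    have hR₂ : ¬ M.Inside R₂ w := hw.elim (L₁.not_inside_of_disjoint hdis w) (L₂.not_inside w)
    refine ⟨?_, ?_, ?_, ?_⟩ <;> rintro rfl <;> contradiction
  have hne' : ∀ {p q s}, M.Inside R₁ p → M.Inside R₂ q → G.Adj p s → p ≠ q := by
    rintro p q s hp hq hps rfl
    exact Set.disjoint_left.1 hdis (hp ⟨(p, s), hps⟩ rfl) (hq ⟨(p, s), hps⟩ rfl)
  have haa := hne' ha₁ ha₂ h₁.ab
  have hab := hne' ha₁ hb₂ h₁.ab
  have hba := hne' hb₁ ha₂ h₁.bv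
  have hbb := hne' hb₁ hb₂ h₁.bv
  simp only [List.mem_cons, List.not_mem_nil, or_false, forall_eq_or_imp, forall_eq] at hne
  obtain ⟨⟨p1, p2, p3, p4⟩, ⟨q1, q2, q3, q4⟩, ⟨r1, r2, r3, r4⟩, ⟨s1, s2, s3, s4⟩,
    ⟨p1', p2', p3', p4'⟩, ⟨q1', q2', q3', q4'⟩, -, ⟨s1', s2', s3', s4'⟩⟩ := hne
  have hu₁v := L₁.huv
  have hu₂v := L₂.huv
  have nab₁ := h₁.ab.ne
  have nab₂ := h₂.ab.ne
  have hadj : G.Adj u₁ u₂ := h₁.adj_ends hG h₂ huu haa hba hbb p1'.symm p2'.symm p3 p4 r4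
    hu₁v hu₂v.symm hab
  have hu₂ : ¬ G.Adj u₂ v := M.not_adj_of_thinPath h5 hG h₁ h₂ (by simp; grind)
  have hu₁ : ¬ G.Adj u₁ v := M.not_adj_of_thinPath h5 hG h₂ h₁ (by simp; grind)
  by_cases c1 : x₁ = x₂
  · subst c1
    exact Or.inr (M.card_le_of_lenses_common h5 hG L₁ L₂ hdis h₁ hadj)
  by_cases c2 : x₁ = y₂
  · subst c2
    exact Or.inr (M.card_le_of_lenses_common h5 hG L₁ L₂.flip hdis h₁ hadj)
  by_cases c3 : y₁ = x₂
  · subst c3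
    exact Or.inr (M.card_le_of_lenses_common h5 hG L₁.flip L₂ hdis h₁ hadj)
  by_cases c4 : y₁ = y₂
  · subst c4
    exact Or.inr (M.card_le_of_lenses_common h5 hG L₁.flip L₂.flip hdis h₁ hadj)
  -- With no shared vertex besides `v`, and neither `u₁` nor `u₂` adjacent to `v`, the eleven
  -- vertices are distinct.
  left
  have e1 : x₁ ≠ u₂ := by rintro rfl; exact hu₂ L₁.xv
  have e2 : y₁ ≠ u₂ := by rintro rfl; exact hu₂ L₁.vy.symm
  have e3 : x₂ ≠ u₁ := by rintro rfl; exact hu₁ L₂.xv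
  have e4 : y₂ ≠ u₁ := by rintro rfl; exact hu₁ L₂.vy.symm
  refine graphI_isContained L₁.ux L₁.xv L₁.vy L₁.yu L₂.ux L₂.xv L₂.vy L₂.yu h₁ h₂ hadj ?_
  have f1 := L₁.ux.ne
  have f2 := L₁.xv.ne
  have f3 := L₁.vy.ne
  have f4 := L₁.yu.ne
  have f5 := L₁.hxy
  have f1' := L₂.ux.ne
  have f2' := L₂.xv.ne
  have f3' := L₂.vy.ne
  have f4' := L₂.yu.ne
  have f5' := L₂.hxy
  simp only [List.nodup_cons, List.mem_cons, List.not_mem_nil, or_false, not_or, not_false_eq_true,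
    List.nodup_nil, and_true]
  grind

theorem lenses [DecidableRel G.Adj] (h5 : M.IsPentagulation) (hG : DistLeThree G)
    {R₁ R₂ : Set M.Face} {u₁ u₂ v₁ v₂ x₁ y₁ x₂ y₂ : V}
    (L₁ : IsLens M.toRotationSystem R₁ u₁ x₁ v₁ y₁) (L₂ : IsLens M.toRotationSystem R₂ u₂ x₂ v₂ y₂)
    (hdis : Disjoint R₁ R₂) (hpair : ({u₁, v₁} : Set V) ≠ {u₂, v₂}) :
    graphI.IsContained G ∨ Fintype.card V + 1 ≤ 3 * G.maxDegree := by
  by_cases c1 : v₁ = v₂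
  · subst c1
    exact M.lenses_common_vertex h5 hG L₁ L₂ hdis (by rintro rfl; exact hpair rfl)
  by_cases c2 : u₁ = u₂
  · subst c2
    exact M.lenses_common_vertex h5 hG L₁.symm L₂.symm hdis c1
  by_cases c3 : u₁ = v₂
  · subst c3
    exact M.lenses_common_vertex h5 hG L₁.symm L₂ hdis
      (by rintro rfl; exact hpair (Set.pair_comm _ _))
  by_cases c4 : v₁ = u₂
  · subst c4
    exact M.lenses_common_vertex h5 hG L₁ L₂.symm hdis c3
  right
  obtain ⟨a₁, b₁, ha₁, hb₁, h₁⟩ := L₁.exists_thinPath h5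
  obtain ⟨a₂, b₂, ha₂, hb₂, h₂⟩ := L₂.exists_thinPath h5
  have hne : ∀ w ∈ [u₁, x₁, v₁, y₁, u₂, x₂, v₂, y₂],
      w ≠ a₁ ∧ w ≠ b₁ ∧ w ≠ a₂ ∧ w ≠ b₂ := by
    intro w hw
    have hw : w ∈ [u₁, x₁, v₁, y₁] ∨ w ∈ [u₂, x₂, v₂, y₂] := by
      simp only [List.mem_cons, List.not_mem_nil, or_false] at hw ⊢
      tauto
    have hR₁ : ¬ M.Inside R₁ w := hw.elim (L₁.not_inside w)
      (L₂.not_inside_of_disjoint hdis.symm w)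
    have hR₂ : ¬ M.Inside R₂ w := hw.elim (L₁.not_inside_of_disjoint hdis w) (L₂.not_inside w)
    refine ⟨?_, ?_, ?_, ?_⟩ <;> rintro rfl <;> contradiction
  have hne' : ∀ {p q s}, M.Inside R₁ p → M.Inside R₂ q → G.Adj p s → p ≠ q := by
    rintro p q s hp hq hps rfl
    exact Set.disjoint_left.1 hdis (hp ⟨(p, s), hps⟩ rfl) (hq ⟨(p, s), hps⟩ rfl)
  have haa := hne' ha₁ ha₂ h₁.ab
  have hab := hne' ha₁ hb₂ h₁.ab
  have hba := hne' hb₁ ha₂ h₁.bv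
  have hbb := hne' hb₁ hb₂ h₁.bv
  simp only [List.mem_cons, List.not_mem_nil, or_false, forall_eq_or_imp, forall_eq] at hne
  obtain ⟨⟨p1, p2, p3, p4⟩, -, ⟨r1, r2, r3, r4⟩, -,
    ⟨p1', p2', p3', p4'⟩, -, ⟨r1', r2', r3', r4'⟩, -⟩ := hne
  have hu₁v := L₁.huv
  have hu₂v := L₂.huv
  have nab₁ := h₁.ab.ne
  have nab₂ := h₂.ab.ne
  -- Each end of one thin path is adjacent to each end of the other, which gives the 4-cycle
  -- `u₁u₂v₁v₂`.
  refine M.card_le_of_thin_paths_quad h5 hG h₁ h₂ (by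
    simp only [List.nodup_cons, List.mem_cons, List.not_mem_nil, or_false, not_or,
      not_false_eq_true, List.nodup_nil, and_true]
    grind) ?_ ?_ ?_ ?_
  · exact h₁.adj_ends hG h₂ c2 haa hba hbb p1'.symm p2'.symm p3 p4 r4 c3 c4 hab
  · exact (h₁.symm.adj_ends hG h₂ c4 hba haa hab p2'.symm p1'.symm r3 r4 p4 c1 c2 hbb).symm
  · exact h₁.symm.adj_ends hG h₂.symm c1 hbb hab haa r2'.symm r1'.symm r4 r3 p3 c4 c3 hba
  · exact (h₁.adj_ends hG h₂.symm c3 hab hbb hba r1'.symm r2'.symm p4 p3 r3 c2 c1 haa).symm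

end PlaneEmbedding

end

/-! ### From 4-cycles as walks and the diameter to lenses -/

section

open RotationSystem
open scoped Classical

namespace PlaneEmbedding

variable {V : Type*} [Fintype V] {G : SimpleGraph V} (M : PlaneEmbedding G)

/-- Let `R` be the side of the cycle with the outer face. The exterior stays in `R` and is closed
under crossing edges within `R`; since `R` is face-connected, they coincide. -/
theorem exterior_isBoundary {a : V} {C : G.Walk a a} {B : Set (Sym2 V)} {P : Finset V}
    (hC : C.edgeSet = B) (hB : IsCycleOn G B P) {R₀ : Set M.Face} (h₀ : M.IsBoundary R₀ B) :
    M.IsBoundary (M.exterior C) B := by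
  obtain ⟨R, hR, hout⟩ : ∃ R : Set M.Face, M.IsBoundary R B ∧ M.outer ∈ R := by
    by_cases h : M.outer ∈ R₀
    exacts [⟨R₀, h₀, h⟩, ⟨R₀ᶜ, h₀.compl, h⟩]
  have hsub : M.exterior C ⊆ R := by
    intro f hf
    induction hf with
    | refl => exact hout
    | tail _ hcr ih =>
      obtain ⟨d, hd, rfl, rfl⟩ := hcr
      rw [hC] at hd
      have := (hR d).not.1 hd
      tauto
  have hcross : ∀ d : G.Dart, d.edge ∉ B → M.face d ∈ M.exterior C →
      M.face d.symm ∈ M.exterior C := fun d hd h =>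
    Relation.ReflTransGen.tail h ⟨d, hC ▸ hd, rfl, rfl⟩
  rcases hR.faceConnected M.connected hB _ hsub (by
    intro d h1 h2
    have hd : d.edge ∉ B := fun h => (hR d).1 h |>.1 h1 h2
    refine ⟨hcross d hd, fun h => ?_⟩
    have := hcross d.symm (by rwa [SimpleGraph.Dart.edge_symm]) h
    rwa [d.symm_symm] at this) with h | h
  · have : M.outer ∈ M.exterior C := Relation.ReflTransGen.refl
    rw [h] at this
    exact this.elim
  · rwa [h]

end PlaneEmbedding

theorem SimpleGraph.Walk.IsCycle.exists_quad {V : Type*} {G : SimpleGraph V} {a : V}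
    {C : G.Walk a a} (hC : C.IsCycle) (hlen : C.length = 4) :
    ∃ p q r s, G.Adj p q ∧ G.Adj q r ∧ G.Adj r s ∧ G.Adj s p ∧ p ≠ r ∧ q ≠ s ∧
      C.edgeSet = quadEdges p q r s ∧ ∀ x, x ∈ C.support ↔ x = p ∨ x = q ∨ x = r ∨ x = s := by
  match C, hC, hlen with
  | .cons (v := q) h1 (.cons (v := r) h2 (.cons (v := s) h3 (.cons h4 .nil))), hC, _ =>
    have hn := hC.support_nodup
    simp only [support_cons, support_nil, List.tail_cons, List.nodup_cons, List.mem_cons,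
      List.not_mem_nil, or_false, not_or] at hn
    refine ⟨a, q, r, s, h1, h2, h3, h4, ?_, hn.1.2.1, ?_, ?_⟩
    · exact Ne.symm hn.2.1.2
    · ext e
      simp [quadEdges, SimpleGraph.Walk.edgeSet]
    · intro x
      simp
      tauto

namespace PlaneEmbedding

variable {V : Type*} [Fintype V] {G : SimpleGraph V} (M : PlaneEmbedding G)

/-- A pair of vertices of a 4-cycle that dominates one of its sides consists of opposite
vertices of the cycle. -/
theorem exists_isLens (h5 : M.IsPentagulation) {a : V} {C : G.Walk a a} (hC : C.IsCycle)
    (hlen : C.length = 4) {R : Set M.Face} (hR : R = M.interior C ∨ R = M.exterior C) {u v : V}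
    (huv : u ≠ v) (hu : u ∈ C.support) (hv : v ∈ C.support) (hdom : M.PairDominates C R u v) :
    ∃ x y, IsLens M.toRotationSystem R u x v y := by
  obtain ⟨p, q, r, s, hpq, hqr, hrs, hsp, hpr, hqs, hedge, hsupp⟩ := hC.exists_quad hlen
  have hB := isCycleOn_quad hpq hqr hrs hsp hpr hqs
  obtain ⟨R₀, h₀⟩ := M.exists_isBoundary_quad hpq hqr hrs hsp hpr hqs
  have hext := M.exterior_isBoundary hedge hB h₀
  have hbd : M.IsBoundary R (quadEdges p q r s) := by
    rcases hR with rfl | rfl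
    exacts [hext.compl, hext]
  have hnt : Nontrivial V := ⟨u, v, huv⟩
  have hdom' : ∀ z, M.Inside R z → G.Adj u z ∨ G.Adj v z := by
    intro z hz
    obtain ⟨d, hd⟩ := exists_dart_fst M.connected z
    refine hdom z ⟨fun hzC => ?_, d, hd, hz d hd⟩
    refine hbd.not_inside_of_mem hB ?_ hz
    simpa using (hsupp z).1 hzC
  have hbd1 : M.IsBoundary R (quadEdges q r s p) := by rwa [quadEdges_rotate]
  have hbd2 : M.IsBoundary R (quadEdges r s p q) := by rwa [quadEdges_rotate]
  have hbd3 : M.IsBoundary R (quadEdges s p q r) := by rwa [quadEdges_rotate]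
  have hdom'' : ∀ z, M.Inside R z → G.Adj v z ∨ G.Adj u z := fun z hz => (hdom' z hz).symm
  -- Consecutive positions are refuted by `not_dominated_quad`; opposite ones give the lens after
  -- rotating the cycle.
  rcases (hsupp u).1 hu with rfl | rfl | rfl | rfl <;>
    rcases (hsupp v).1 hv with rfl | rfl | rfl | rfl <;>
      first
      | exact absurd rfl huv
      | exact ⟨_, _, hpq, hqr, hrs, hsp, hpr, hqs, hbd, hdom'⟩
      | exact ⟨_, _, hqr, hrs, hsp, hpq, hqs, hpr.symm, hbd1, hdom'⟩
      | exact ⟨_, _, hrs, hsp, hpq, hqr, hpr.symm, hqs.symm, hbd2, hdom'⟩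
      | exact ⟨_, _, hsp, hpq, hqr, hrs, hqs.symm, hpr, hbd3, hdom'⟩
      | exact (M.not_dominated_quad h5 hpq hqr hrs hsp hpr hqs hbd hdom').elim
      | exact (M.not_dominated_quad h5 hqr hrs hsp hpq hqs hpr.symm hbd1 hdom').elim
      | exact (M.not_dominated_quad h5 hrs hsp hpq hqr hpr.symm hqs.symm hbd2 hdom').elim
      | exact (M.not_dominated_quad h5 hsp hpq hqr hrs hqs.symm hpr hbd3 hdom').elim
      | exact (M.not_dominated_quad h5 hpq hqr hrs hsp hpr hqs hbd hdom'').elim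
      | exact (M.not_dominated_quad h5 hqr hrs hsp hpq hqs hpr.symm hbd1 hdom'').elim
      | exact (M.not_dominated_quad h5 hrs hsp hpq hqr hpr.symm hqs.symm hbd2 hdom'').elim
      | exact (M.not_dominated_quad h5 hsp hpq hqr hrs hqs.symm hpr hbd3 hdom'').elim

end PlaneEmbedding

theorem distLeThree_of_diam {V : Type*} [Finite V] {G : SimpleGraph V} (hc : G.Connected)
    (hdiam : G.diam = 3) : DistLeThree G := by
  intro z w
  have hnt : Nonempty V := ⟨z⟩
  have hne : G.ediam ≠ ⊤ := G.connected_iff_ediam_ne_top.1 hc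
  have hle : G.dist z w ≤ 3 := hdiam ▸ SimpleGraph.dist_le_diam hne
  obtain ⟨p, hp⟩ := hc.exists_walk_length_eq_dist z w
  rw [← hp] at hle
  match p, hle with
  | .nil, _ => exact Or.inl rfl
  | .cons h1 .nil, _ => exact Or.inr (Or.inl h1)
  | .cons h1 (.cons h2 .nil), _ => exact Or.inr (Or.inr (Or.inl ⟨_, h1, h2⟩))
  | .cons h1 (.cons h2 (.cons h3 .nil)), _ => exact Or.inr (Or.inr (Or.inr ⟨_, _, h1, h2, h3⟩))
  | .cons _ (.cons _ (.cons _ (.cons _ p))), h =>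
    simp only [SimpleGraph.Walk.length_cons] at h
    omega

end

theorem mainTheorem6 {V : Type*} [Fintype V] (G : SimpleGraph V) [DecidableRel G.Adj]
    (M : PlaneEmbedding G) (hM : M.IsPentagulation) (hdiam : G.diam = 3)
    (hΔ : 3 ≤ G.maxDegree)
    (hdisl : ∃ (a b : V) (C₁ : G.Walk a a) (C₂ : G.Walk b b), M.Dislocated C₁ C₂) :
    graphI.IsContained G ∨ Fintype.card V ≤ 3 * G.maxDegree - 1 := by
  obtain ⟨a, b, C₁, C₂, ⟨hC₁, hl₁⟩, ⟨hC₂, hl₂⟩, -, R₁, R₂, hR₁, hR₂, u₁, v₁, u₂, v₂,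
    ⟨huv₁, hu₁, hv₁⟩, ⟨huv₂, hu₂, hv₂⟩, hdom₁, hdom₂, hpair, hdis⟩ := hdisl
  obtain ⟨x₁, y₁, L₁⟩ := M.exists_isLens hM hC₁ hl₁ hR₁ huv₁ hu₁ hv₁ hdom₁
  obtain ⟨x₂, y₂, L₂⟩ := M.exists_isLens hM hC₂ hl₂ hR₂ huv₂ hu₂ hv₂ hdom₂
  rcases M.lenses hM (distLeThree_of_diam M.connected hdiam) L₁ L₂ hdis hpair with h | h
  · exact Or.inl h
  · exact Or.inr (by omega)
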